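/- Let $\mathcal B$ be a commutative $\mathbb C$-algebra of functions of the times $\mathbf t_\nu=(t_{\nu,1},t_{\nu,2},\dots)$, $\nu\in\{1,2\}$ (for instance smooth functions on a domain, or formal power series), with pairwise commuting derivations $\partial/\partial t_{\nu,k}$, $k\ge1$; put $x=t_{1,1}$, $y=t_{2,1}$, $\partial_1=\partial/\partial x$, $\partial_2=\partial/\partial y$. Let $\mathcal E$ be the algebra of pseudo-differential operators $\sum_{i\le m}\sum_{j\le n}f_{ij}\partial_1^i\partial_2^j$ ($f_{ij}\in\mathcal B$, $m,n\in\mathbb Z$) with the product $$f\partial_1^i\partial_2^j\cdot g\,\partial_1^p\partial_2^q=\sum_{r,s\ge0}\binom ir\binom js f\,\partial_1^r\partial_2^s(g)\,\partial_1^{i+p-r}\partial_2^{j+q-s}$$ and the adjoint $\big(\sum f_{ij}\partial_1^i\partial_2^j\big)^*=\sum(-1)^{i+j}\partial_1^i\partial_2^jf_{ij}$. For operators $\sum_i f_i\partial_\nu^i$ in a single derivation, subscripts $\ge m$ and $<m$ denote truncation to the powers $i\ge m$ and $i<m$; for a differential operator $D$, $D\langle A\rangle$ is $D$ applied to each coefficient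 of $A$. The KP-mKP hierarchy is the following system for operators $\Phi_1=1+\sum_{i\ge1}a_{1,i}\partial_1^{-i}$ and $\Phi_2=e^\beta\big(1+\sum_{i\ge1}a_{2,i}\partial_2^{-i}\big)$ with coefficients in $\mathcal B$ (where $e^\beta$ denotes an invertible element of $\mathcal B$, and $e^{-\beta}$ its inverse), with $P_\nu=\Phi_\nu\partial_\nu\Phi_\nu^{-1}$ and for all $k\ge1$: $$\frac{\partial\Phi_1}{\partial t_{1,k}}=-(P_1^k)_{<0}\Phi_1,\quad \frac{\partial\Phi_2}{\partial t_{2,k}}=-(P_2^k)_{<1}\Phi_2,\quad \frac{\partial\Phi_1}{\partial t_{2,k}}=(P_2^k)_{\ge1}\langle\Phi_1\rangle,\quad \frac{\partial\Phi_2}{\partial t_{1,k}}=(P_1^k)_{\ge0}\langle\Phi_2\rangle,$$ $$e^\beta\partial_1e^{-\beta}\,\Phi_1\partial_2\Phi_1^{-1}=\partial_2\Phi_2\partial_1\Phi_2^{-1}.$$ Let $\xi(\mathbf t_\nu;z)=\sum_{k\ge1}t_{\nu,k}z^k$ and $\big(\sum_i f_i\partial_\nu^i\big)e^{\pm\xi(\mathbf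 t_\nu;z)}=\big(\sum_i f_i(\pm z)^i\big)e^{\pm\xi(\mathbf t_\nu;z)}$, and let $\mathrm{res}_z\sum_i f_iz^i=f_{-1}$. The Baker–Akhiezer functions and adjoint Baker–Akhiezer functions of a solution $(\Phi_1,\Phi_2)$ are $$w_\nu=\Phi_\nu e^{\xi(\mathbf t_\nu;z)}\ (\nu=1,2),\qquad w_1^*=(\Phi_1^{-1})^*e^{-\xi(\mathbf t_1;z)},\qquad w_2^*=\bar\Phi_2^*e^{-\xi(\mathbf t_2;z)},$$ where $\bar\Phi_2=\partial_2^2\Phi_2^{-1}\partial_2^{-1}\rho\,\partial_2^{-1}$ and $\rho=\partial_2(a_{1,1})$. Consider the bilinear equation $$\mathrm{res}_z\big(w_1(\mathbf t_1,\mathbf t_2;z)\,w_1^*(\mathbf t_1',\mathbf t_2';z)\big)=\mathrm{res}_z\big(z^{-2}w_2(\mathbf t_1,\mathbf t_2;z)\,w_2^*(\mathbf t_1',\mathbf t_2';z)\big)\qquad(\star)$$ for arbitrary times $\mathbf t=(\mathbf t_1,\mathbf t_2)$ and $\mathbf t'=(\mathbf t_1',\mathbf t_2')$, understood as an identity of formal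 power series in $\mathbf s=\mathbf t-\mathbf t'$ with coefficients in $\mathcal B$, via $f(\mathbf t'+\mathbf s)=\sum_{\mathbf m}\frac{\mathbf s^{\mathbf m}}{\mathbf m!}(\partial^{\mathbf m}f)(\mathbf t')$ and $e^{\xi(\mathbf t_\nu;z)}e^{-\xi(\mathbf t'_\nu;z)}=e^{\xi(\mathbf s_\nu;z)}$. **Theorem.** (a) For every solution of the KP-mKP hierarchy, its Baker–Akhiezer and adjoint Baker–Akhiezer functions satisfy $(\star)$. (b) Conversely, suppose that four functions of the form $$w_1=\Big(1+\sum_{i\ge1}a_{1,i}z^{-i}\Big)e^{\xi(\mathbf t_1;z)},\qquad w_2=e^{\beta}\Big(1+\sum_{i\ge1}a_{2,i}z^{-i}\Big)e^{\xi(\mathbf t_2;z)},$$ $$w_1^*=\Big(1+\sum_{i\ge1}\tilde a_{1,i}z^{-i}\Big)e^{-\xi(\mathbf t_1;z)},\qquad w_2^*=e^{-\beta}\Big(\tilde\rho+\sum_{i\ge1}\tilde a_{2,i}z^{-i}\Big)e^{-\xi(\mathbf t_2;z)},$$ with coefficients $a_{\nu,i},\tilde a_{\nu,i},\tilde\rho\in\mathcal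 B$ and $e^{\beta}$ invertible in $\mathcal B$, satisfy $(\star)$, and that $\partial a_{1,1}/\partial t_{2,1}$ is not a zero divisor in $\mathcal B$ (if $\mathcal B$ is an integral domain: $\partial a_{1,1}/\partial t_{2,1}\ne0$). Then $\Phi_1=1+\sum_{i\ge1}a_{1,i}\partial_1^{-i}$ and $\Phi_2=e^\beta\big(1+\sum_{i\ge1}a_{2,i}\partial_2^{-i}\big)$ solve the KP-mKP hierarchy, and $w_1,w_2,w_1^*,w_2^*$ are its Baker–Akhiezer and adjoint Baker–Akhiezer functions as defined above; in particular $\tilde\rho=\partial a_{1,1}/\partial t_{2,1}$. -/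

import Mathlib

/-!
The KP-mKP hierarchy, its Baker–Akhiezer functions and the bilinear equation.

The index `0 : Fin 2` is the first component (`x`, `∂₁`, `t₁`), the index `1 : Fin 2` is the second
one (`y`, `∂₂`, `t₂`).  The time `t_{ν,k}`, `k ≥ 1`, has the index `(ν, k) : Time`.
-/

noncomputable section

namespace KPmKP

/-- The index set of the times `t_{ν,k}`, `ν ∈ {1,2}`, `k ≥ 1`. -/
abbrev Time := Fin 2 × ℕ+

/-- The partial derivatives `∂/∂t_{ν,k}` of an algebra `A` of functions of the times: commuting
`ℂ`-linear derivations.  Smooth complex functions on a domain, analytic or meromorphic functions,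
and formal power series in the times are all instances. -/
structure TimeDerivations (A : Type*) [CommRing A] [Algebra ℂ A] where
  /-- the derivation `∂/∂t_{ν,k}` -/
  D : Time → Derivation ℂ A A
  comm : ∀ (i j : Time) (f : A), D i (D j f) = D j (D i f)

variable {A : Type*} [CommRing A] [Algebra ℂ A]

namespace TimeDerivations

variable (F : TimeDerivations A)

/-- The space derivations: `∂₁ = ∂/∂x = ∂/∂t_{1,1}` and `∂₂ = ∂/∂y = ∂/∂t_{2,1}`. -/
def del (ν : Fin 2) : A → A := F.D (ν, 1)

/-- `∂₁^{r₁} ∂₂^{r₂}` applied to a function. -/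
def delPow (r : Fin 2 → ℕ) (f : A) : A := (F.del 0)^[r 0] ((F.del 1)^[r 1] f)

lemma delPow_zero (r : Fin 2 → ℕ) : F.delPow r 0 = 0 := by
  have h : ∀ ν n, (F.del ν)^[n] 0 = 0 := by
    intro ν n
    exact Function.iterate_fixed (map_zero (F.D (ν, 1))) n
  simp [delPow, h]

/-- `∂^m = ∏ (∂/∂t_{ν,k})^{m_{ν,k}}` for a multi-index `m` of times. -/
def timePow (m : Time →₀ ℕ) : Module.End ℂ A :=
  m.support.noncommProd (fun i => (F.D i : Module.End ℂ A) ^ m i) (by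
    intro i _ j _ _
    have h : Commute (F.D i : Module.End ℂ A) (F.D j : Module.End ℂ A) :=
      LinearMap.ext fun f => F.comm i j f
    exact h.pow_pow _ _)

end TimeDerivations

/-! ### Pseudo-differential operators with two derivations -/

/-- A pseudo-differential operator `∑_{i ≤ m} ∑_{j ≤ n} f_{ij} ∂₁^i ∂₂^j`; `coeff ![i, j]` is
`f_{ij}`.  The coefficient functions are written on the left of the derivations. -/
@[ext]
structure PDO (F : TimeDerivations A) where
  coeff : (Fin 2 → ℤ) → A
  bdd : ∃ m : Fin 2 → ℤ, ∀ α, coeff α ≠ 0 → α ≤ m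

namespace PDO

variable {F : TimeDerivations A}

/-- The operator `f ∂₁^{α₁} ∂₂^{α₂}`. -/
def monomial (F : TimeDerivations A) (α : Fin 2 → ℤ) (f : A) : PDO F where
  coeff := Pi.single α f
  bdd := ⟨α, fun β h => by
    by_cases e : β = α
    · exact e.le
    · exact absurd (Pi.single_eq_of_ne (M := fun _ => A) e f) h⟩

/-- Multiplication by the function `f`, as an operator. -/
def fn (F : TimeDerivations A) (f : A) : PDO F := monomial F 0 f

/-- The operator `∂_ν^n`, `n ∈ ℤ`. -/
def dpow (F : TimeDerivations A) (ν : Fin 2) (n : ℤ) : PDO F := monomial F (Pi.single ν n) 1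

instance : Zero (PDO F) := ⟨⟨0, ⟨0, fun _ h => absurd rfl h⟩⟩⟩

instance : One (PDO F) := ⟨fn F 1⟩

instance : Neg (PDO F) :=
  ⟨fun P => ⟨fun α => -P.coeff α, P.bdd.imp fun _ hm α h => hm α (fun e => h (by simp [e]))⟩⟩

/-- The product, determined by
`f ∂₁^i ∂₂^j · g ∂₁^p ∂₂^q
  = ∑_{r,s ≥ 0} (i choose r) (j choose s) f ∂₁^r∂₂^s(g) ∂₁^{i+p-r} ∂₂^{j+q-s}`.
The coefficient at the exponent `γ` is a sum over the exponent `α = p.1` in the left factor and over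
`r = p.2`; only finitely many terms are nonzero. -/
instance : Mul (PDO F) :=
  ⟨fun P Q =>
    { coeff := fun γ => ∑ᶠ p : (Fin 2 → ℤ) × (Fin 2 → ℕ),
        (∏ μ, Ring.choose (p.1 μ) (p.2 μ)) •
          (P.coeff p.1 * F.delPow p.2 (Q.coeff (fun μ => γ μ - p.1 μ + p.2 μ)))
      bdd := by
        obtain ⟨m, hm⟩ := P.bdd
        obtain ⟨n, hn⟩ := Q.bdd
        refine ⟨m + n, fun γ h => ?_⟩
        obtain ⟨p, hp⟩ := not_forall.1 (mt finsum_eq_zero_of_forall_eq_zero h)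
        have h1 : P.coeff p.1 ≠ 0 := fun e => hp (by simp [e])
        have h2 : Q.coeff (fun μ => γ μ - p.1 μ + p.2 μ) ≠ 0 := fun e =>
          hp (by simp [e, F.delPow_zero])
        intro μ
        have h3 := hm _ h1 μ
        have h4 := hn _ h2 μ
        simp only [Pi.add_apply] at *
        omega }⟩

/-- `P ^ k` is the `k`-fold product of `P`. -/
instance : Pow (PDO F) ℕ := ⟨fun P k => (fun Q => P * Q)^[k] 1⟩

open Classical in
/-- The two-sided inverse `P⁻¹` of an invertible operator (and `0` if `P` is not invertible). -/
instance : Inv (PDO F) :=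
  ⟨fun P => if h : ∃ Q : PDO F, P * Q = 1 ∧ Q * P = 1 then h.choose else 0⟩

/-- The adjoint `(∑ f_{ij} ∂₁^i ∂₂^j)^* = ∑ (-1)^{i+j} ∂₁^i ∂₂^j · f_{ij}`, with the functions moved
to the left by the product rule. -/
def adjoint (P : PDO F) : PDO F where
  coeff γ := ∑ᶠ r : Fin 2 → ℕ,
    (Int.negOnePow (∑ μ, (γ μ + r μ)) : ℤ) • (∏ μ, Ring.choose (γ μ + r μ) (r μ)) •
      F.delPow r (P.coeff (fun μ => γ μ + r μ))
  bdd := by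
    obtain ⟨m, hm⟩ := P.bdd
    refine ⟨m, fun γ h => ?_⟩
    obtain ⟨r, hr⟩ := not_forall.1 (mt finsum_eq_zero_of_forall_eq_zero h)
    have h2 : P.coeff (fun μ => γ μ + r μ) ≠ 0 := fun e => hr (by simp [e, F.delPow_zero])
    intro μ
    have h4 : γ μ + r μ ≤ m μ := hm _ h2 μ
    have h5 : γ μ ≤ γ μ + r μ := by omega
    exact h5.trans h4

/-- The truncation `P_{≥ n} = ∑_{i ≥ n} f_i ∂_ν^i` of an operator `P = ∑ f_i ∂_ν^i`. -/
def truncGE (ν : Fin 2) (n : ℤ) (P : PDO F) : PDO F where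
  coeff α := if n ≤ α ν then P.coeff α else 0
  bdd := P.bdd.imp fun _ hm α h => hm α (fun e => h (by simp [e]))

/-- The truncation `P_{< n} = ∑_{i < n} f_i ∂_ν^i` of an operator `P = ∑ f_i ∂_ν^i`. -/
def truncLT (ν : Fin 2) (n : ℤ) (P : PDO F) : PDO F where
  coeff α := if α ν < n then P.coeff α else 0
  bdd := P.bdd.imp fun _ hm α h => hm α (fun e => h (by simp [e]))

/-- The action `L⟨P⟩` of a differential operator `L = ∑_{r,s ≥ 0} g_{rs} ∂₁^r ∂₂^s` on the
coefficients of `P`. -/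
def act (L P : PDO F) : PDO F where
  coeff α := ∑ᶠ r : Fin 2 → ℕ, L.coeff (fun μ => (r μ : ℤ)) * F.delPow r (P.coeff α)
  bdd := P.bdd.imp fun m hm α h => hm α (fun e => h (by simp [e, F.delPow_zero]))

/-- The derivative `∂P/∂t_i` of all coefficients of `P` with respect to the time `t_i`. -/
def dt (i : Time) (P : PDO F) : PDO F where
  coeff α := F.D i (P.coeff α)
  bdd := P.bdd.imp fun m hm α h => hm α (fun e => h (by simp [e]))

/-- The operator `u (1 + ∑_{i ≥ 1} a_i ∂_ν^{-i})`.  (The value `a 0` is not used.) -/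
def dressing (F : TimeDerivations A) (ν : Fin 2) (u : A) (a : ℕ → A) : PDO F where
  coeff α := if α = Pi.single ν (α ν) ∧ α ν ≤ 0 then
    (if α ν = 0 then u else u * a (-(α ν)).toNat) else 0
  bdd := ⟨0, fun α h => by
    have h' : α = Pi.single ν (α ν) ∧ α ν ≤ 0 := by
      by_contra h''
      exact h (if_neg h'')
    rw [h'.1]
    intro μ
    by_cases e : μ = ν
    · subst e
      simpa using h'.2
    · simp [Pi.single_eq_of_ne e]⟩

end PDO

/-! ### The hierarchy -/

open PDO

/-- `Φ₁ = 1 + ∑_{i ≥ 1} a_{1,i} ∂₁^{-i}`. -/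
def Phi1 (F : TimeDerivations A) (a₁ : ℕ → A) : PDO F := dressing F 0 1 a₁

/-- `Φ₂ = e^β (1 + ∑_{i ≥ 1} a_{2,i} ∂₂^{-i})`, where the invertible function `e^β` is `E`. -/
def Phi2 (F : TimeDerivations A) (E : Aˣ) (a₂ : ℕ → A) : PDO F := dressing F 1 E a₂

/-- `P_ν = Φ_ν ∂_ν Φ_ν⁻¹`. -/
def lax {F : TimeDerivations A} (ν : Fin 2) (Φ : PDO F) : PDO F := Φ * dpow F ν 1 * Φ⁻¹

/-- `ρ = ∂₂(a_{1,1})`. -/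
def rho (F : TimeDerivations A) (a₁ : ℕ → A) : A := F.del 1 (a₁ 1)

/-- The operators `Φ₁ = 1 + ∑ a_{1,i} ∂₁^{-i}` and `Φ₂ = E (1 + ∑ a_{2,i} ∂₂^{-i})`, `E = e^β`, solve
the KP-mKP hierarchy. -/
structure IsSolution (F : TimeDerivations A) (E : Aˣ) (a₁ a₂ : ℕ → A) : Prop where
  /-- `∂Φ₁/∂t_{1,k} = -(P₁^k)_{<0} Φ₁` -/
  flow11 : ∀ k : ℕ+, dt (0, k) (Phi1 F a₁) =
    -(truncLT 0 0 (lax 0 (Phi1 F a₁) ^ (k : ℕ))) * Phi1 F a₁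
  /-- `∂Φ₂/∂t_{2,k} = -(P₂^k)_{<1} Φ₂` -/
  flow22 : ∀ k : ℕ+, dt (1, k) (Phi2 F E a₂) =
    -(truncLT 1 1 (lax 1 (Phi2 F E a₂) ^ (k : ℕ))) * Phi2 F E a₂
  /-- `∂Φ₁/∂t_{2,k} = (P₂^k)_{≥1}⟨Φ₁⟩` -/
  flow21 : ∀ k : ℕ+, dt (1, k) (Phi1 F a₁) =
    act (truncGE 1 1 (lax 1 (Phi2 F E a₂) ^ (k : ℕ))) (Phi1 F a₁)
  /-- `∂Φ₂/∂t_{1,k} = (P₁^k)_{≥0}⟨Φ₂⟩` -/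
  flow12 : ∀ k : ℕ+, dt (0, k) (Phi2 F E a₂) =
    act (truncGE 0 0 (lax 0 (Phi1 F a₁) ^ (k : ℕ))) (Phi2 F E a₂)
  /-- `e^β ∂₁ e^{-β} Φ₁ ∂₂ Φ₁⁻¹ = ∂₂ Φ₂ ∂₁ Φ₂⁻¹` -/
  constraint : fn F (E : A) * dpow F 0 1 * fn F ((E⁻¹ : Aˣ) : A) *
      Phi1 F a₁ * dpow F 1 1 * (Phi1 F a₁)⁻¹ =
    dpow F 1 1 * Phi2 F E a₂ * dpow F 0 1 * (Phi2 F E a₂)⁻¹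

/-- `Φ̄₂ = ∂₂² Φ₂⁻¹ ∂₂⁻¹ ρ ∂₂⁻¹`. -/
def Phi2bar (F : TimeDerivations A) (E : Aˣ) (a₁ a₂ : ℕ → A) : PDO F :=
  dpow F 1 2 * (Phi2 F E a₂)⁻¹ * dpow F 1 (-1) * fn F (rho F a₁) * dpow F 1 (-1)

/-! ### Wave functions

A function of the form `L(t; z) e^{ξ(t_ν; z)}` or `L(t; z) e^{-ξ(t_ν; z)}`, where `L` is a formal
series in `z` with finitely many positive powers of `z` and coefficients in `A`, is recorded by its
amplitude `L`.  Amplitudes are Laurent series in `z⁻¹`: the coefficient of `z^i` in `L` is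
`L.coeff (-i)`. -/

/-- The amplitude `∑ f_i z^i` of `P e^{ξ(t_ν; z)}`, where `P = ∑ f_i ∂_ν^i`. -/
def ampPos {F : TimeDerivations A} (ν : Fin 2) (P : PDO F) : LaurentSeries A :=
  HahnSeries.ofSuppBddBelow (fun n => P.coeff (Pi.single ν (-n))) (by
    obtain ⟨m, hm⟩ := P.bdd
    refine ⟨-(m ν), fun n hn => ?_⟩
    have h := hm _ hn ν
    simp only [Pi.single_eq_same] at h
    omega)

/-- The amplitude `∑ f_i (-z)^i` of `P e^{-ξ(t_ν; z)}`, where `P = ∑ f_i ∂_ν^i`. -/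
def ampNeg {F : TimeDerivations A} (ν : Fin 2) (P : PDO F) : LaurentSeries A :=
  HahnSeries.ofSuppBddBelow (fun n => (Int.negOnePow n : ℤ) • P.coeff (Pi.single ν (-n))) (by
    obtain ⟨m, hm⟩ := P.bdd
    refine ⟨-(m ν), fun n hn => ?_⟩
    have h := hm (Pi.single ν (-n)) (fun e => hn (by simp [e])) ν
    simp only [Pi.single_eq_same] at h
    omega)

/-- The amplitude of the Baker–Akhiezer function `w₁ = Φ₁ e^{ξ(t₁; z)}`. -/
def w1 (F : TimeDerivations A) (a₁ : ℕ → A) : LaurentSeries A := ampPos 0 (Phi1 F a₁)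

/-- The amplitude of the Baker–Akhiezer function `w₂ = Φ₂ e^{ξ(t₂; z)}`. -/
def w2 (F : TimeDerivations A) (E : Aˣ) (a₂ : ℕ → A) : LaurentSeries A := ampPos 1 (Phi2 F E a₂)

/-- The amplitude of the adjoint Baker–Akhiezer function `w₁^* = (Φ₁⁻¹)^* e^{-ξ(t₁; z)}`. -/
def w1star (F : TimeDerivations A) (a₁ : ℕ → A) : LaurentSeries A :=
  ampNeg 0 (adjoint (Phi1 F a₁)⁻¹)

/-- The amplitude of the adjoint Baker–Akhiezer function `w₂^* = (Φ̄₂)^* e^{-ξ(t₂; z)}`. -/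
def w2star (F : TimeDerivations A) (E : Aˣ) (a₁ a₂ : ℕ → A) : LaurentSeries A :=
  ampNeg 1 (adjoint (Phi2bar F E a₁ a₂))

/-- The series `c + ∑_{i ≥ 1} b_i z^{-i}`.  (The value `b 0` is not used.) -/
def tailSeries (c : A) (b : ℕ → A) : LaurentSeries A :=
  HahnSeries.ofPowerSeries ℤ A (PowerSeries.mk fun i => if i = 0 then c else b i)

/-! ### The bilinear equation

The times `t` are expanded formally around the times `t'`: one writes `t = t' + s` with formal
variables `s_{ν,k}`, and a function `f` has the expansion
`f(t' + s) = ∑_m (s^m / m!) (∂^m f)(t')`. -/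

/-- The expansion `L(t' + s; z)` as a power series in `s`. -/
def shift (F : TimeDerivations A) (L : LaurentSeries A) : MvPowerSeries Time (LaurentSeries A) :=
  fun m => HahnSeries.map L (((m.prod fun _ n => (n.factorial : ℂ))⁻¹) • F.timePow m)

open Classical in
/-- The series `e^{ξ(s_ν; z)} = ∏_{k ≥ 1} ∑_{n ≥ 0} (s_{ν,k} z^k)^n / n!` as a power series in `s`:
the coefficient of `s^m` is `z^{∑ k m_{ν,k}} / m!` if `s^m` contains only times of the component `ν`,
and `0` otherwise. -/
def expXi (A : Type*) [CommRing A] [Algebra ℂ A] (ν : Fin 2) :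
    MvPowerSeries Time (LaurentSeries A) :=
  fun m => if ∀ i ∈ m.support, i.1 = ν then
    HahnSeries.single (-(m.sum fun i n => ((i.2 : ℕ) * n : ℤ)))
      (algebraMap ℂ A (m.prod fun _ n => (n.factorial : ℂ))⁻¹) else 0

/-- The product `w(t; z) w^*(t'; z)`, `t = t' + s`, of the functions `w = L e^{ξ(t_ν; z)}` and
`w^* = L^* e^{-ξ(t_ν; z)}`: it is `L(t' + s; z) L^*(t'; z) e^{ξ(s_ν; z)}`. -/
def twoTimes (F : TimeDerivations A) (ν : Fin 2) (L Lstar : LaurentSeries A) :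
    MvPowerSeries Time (LaurentSeries A) :=
  shift F L * MvPowerSeries.C Lstar * expXi A ν

/-- `res_z (∑ f_i z^i) = f_{-1}`, for each power of `s`. -/
def resz (W : MvPowerSeries Time (LaurentSeries A)) : MvPowerSeries Time A :=
  fun m => (MvPowerSeries.coeff m W).coeff 1

/-- The bilinear equation
`res_z (w₁(t; z) w₁^*(t'; z)) = res_z (z⁻² w₂(t; z) w₂^*(t'; z))` for all pairs of times `t`, `t'`,
for functions with the given amplitudes. -/
def Bilinear (F : TimeDerivations A) (L₁ L₁star L₂ L₂star : LaurentSeries A) : Prop :=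
  resz (twoTimes F 0 L₁ L₁star) =
    resz (MvPowerSeries.C (HahnSeries.single 2 1) * twoTimes F 1 L₂ L₂star)

end KPmKP

end

/-!
For a pair `w = (w₁, w₂)` of wave functions, the time derivative `∂/∂t_{ν,k}` acts on the amplitudes
as `timeAct`, and the coefficients of the bilinear equation in the powers of `t - t'` say that the
`A`-linear form `v ↦ res_z (v₁ w₁^*) - res_z (z⁻² v₂ w₂^*)` (`pairing`) vanishes on all time
derivatives of `w`, or, equivalently, on some `A`-module that contains `w` and is stable under all
time derivatives (`bilinear_iff_exists_stable`).

The hierarchy is a system of linear equations for `w` (`isSolution_iff`): the flows say that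
`∂w/∂t_{ν,k} = B w`, where `B` is the differential operator `(P₁^k)_{≥ 0}` or `(P₂^k)_{≥ 1}`, and the
constraint says that `∂₁∂₂ w = (∂₁β) ∂₂ w + ρ w`.  For the constraint, one moves the derivations to
the left; then one side is an operator in `∂₁` only and the other side is an operator in `∂₂` only, so
that both are functions (`constraint_iff`).

From the hierarchy to the bilinear equation: by the linear system, the module spanned by the pure
derivatives `∂₁^p w`, `∂₂^q w` is stable (`timeAct_mem_pureSpan`).  On these generators the pairing
vanishes by a computation of residues of operators: `res ∂₁^p Φ₁ Φ₁⁻¹ = 0`, and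
`res ∂₂^q Φ₂ ∂₂⁻² Φ̄₂ = ∂₂^{q-1}(ρ)` is the residue of `∂₂^q⟨Φ₁⟩ Φ₁⁻¹`
(`residue_w1_w1star`, `residue_w2_w2star`, `residue_w1_of_coeff_zero_eq_one`).

From the bilinear equation to the hierarchy: if `v` lies in a stable module on which the pairing
vanishes, `v₁` has order at most `-1` in `z` and `v₂` has order at most `0`, then `v = 0`: the residues
for `∂₁^p v` and `∂₂^q v` are triangular in the coefficients of `v`, and their diagonal entries are `1`
and the leading coefficient of `w₂^*`, which is `e^{-β}ρ` (`eq_zero_of_mem_stable`).  The difference of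
the two sides of each equation of the linear system is such a `v`.  The adjoint functions are
determined by the same triangular residues (`eq_of_coeff_timeOp_mul_eq`).

The identities between operators need the ring structure on `PDO F`.  Its associativity follows from
`∂_ν (Q R) = (∂_ν Q) R`, a consequence of the Leibniz and Pascal rules, since left multiplication by
`∂_ν` is injective, which extends this identity to negative powers of `∂_ν` (`PDO.leftD_mul`).
-/

noncomputable section

namespace KPmKP

section

variable {A : Type*} [CommRing A] [Algebra ℂ A]

namespace TimeDerivations
variable (F : TimeDerivations A)

lemma delPow_add (r : Fin 2 → ℕ) (f g : A) :
    F.delPow r (f + g) = F.delPow r f + F.delPow r g := by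
  have h : ∀ ν n (f g : A), (F.del ν)^[n] (f + g) = (F.del ν)^[n] f + (F.del ν)^[n] g :=
    fun ν n f g => iterate_map_add (F.D (ν, 1)) n f g
  simp [delPow, h]

lemma delPow_add_single (r : Fin 2 → ℕ) (ν : Fin 2) (f : A) :
    F.delPow (r + Pi.single ν 1) f = F.D (ν, 1) (F.delPow r f) := by
  have hc : Function.Commute (F.del 0) (F.del 1) := fun f => F.comm _ _ f
  fin_cases ν
  · simp [delPow, Function.iterate_succ_apply', del]
  · simp only [delPow, Fin.mk_one, Pi.add_apply, Pi.single_eq_same, ne_eq, zero_ne_one,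
      not_false_eq_true, Pi.single_eq_of_ne, add_zero, Function.iterate_succ_apply']
    exact (hc.iterate_left (r 0)) _

end TimeDerivations

namespace PDO
variable {F : TimeDerivations A}

/-! ### The ring of pseudo-differential operators -/

instance : Add (PDO F) :=
  ⟨fun P Q => ⟨P.coeff + Q.coeff, by
    obtain ⟨m, hm⟩ := P.bdd
    obtain ⟨n, hn⟩ := Q.bdd
    refine ⟨m ⊔ n, fun α h => ?_⟩
    by_cases hP : P.coeff α = 0
    · have hQ : Q.coeff α ≠ 0 := fun e => h (by simp [hP, e])
      exact (hn α hQ).trans le_sup_right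
    · exact (hm α hP).trans le_sup_left⟩⟩

@[simp] lemma coeff_add (P Q : PDO F) (α) : (P + Q).coeff α = P.coeff α + Q.coeff α := rfl
@[simp] lemma coeff_zero (α) : (0 : PDO F).coeff α = 0 := rfl
@[simp] lemma coeff_neg (P : PDO F) (α) : (-P).coeff α = -P.coeff α := rfl
lemma coeff_one (α) : (1 : PDO F).coeff α = (Pi.single 0 1 : (Fin 2 → ℤ) → A) α := rfl
lemma coeff_monomial (β : Fin 2 → ℤ) (f : A) (α) :
    (monomial F β f).coeff α = (Pi.single β f : (Fin 2 → ℤ) → A) α := rfl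

instance : AddCommGroup (PDO F) where
  add_assoc P Q R := by ext; simp [add_assoc]
  zero_add P := by ext; simp
  add_zero P := by ext; simp
  add_comm P Q := by ext; simp [add_comm]
  neg_add_cancel P := by ext; simp
  nsmul := nsmulRec
  zsmul := zsmulRec

@[simp] lemma coeff_sub (P Q : PDO F) (α) : (P - Q).coeff α = P.coeff α - Q.coeff α := by
  rw [sub_eq_add_neg, sub_eq_add_neg]; rfl

/-- The coefficients of an operator, as an additive map. -/
def coeffHom (F : TimeDerivations A) (α : Fin 2 → ℤ) : PDO F →+ A where
  toFun P := P.coeff α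
  map_zero' := rfl
  map_add' _ _ := rfl

lemma coeff_sum {ι : Type*} (s : Finset ι) (f : ι → PDO F) (α) :
    (∑ i ∈ s, f i).coeff α = ∑ i ∈ s, (f i).coeff α :=
  map_sum (coeffHom F α) f s

lemma finite_leftD (α γ : Fin 2 → ℤ) (Q : PDO F) :
    (Function.support fun r : Fin 2 → ℕ => (∏ μ, Ring.choose (α μ) (r μ)) •
      F.delPow r (Q.coeff (fun μ => γ μ - α μ + r μ))).Finite := by
  obtain ⟨n, hn⟩ := Q.bdd
  refine (Set.finite_Iic fun μ => (n μ - γ μ + α μ).toNat).subset fun r hr μ => ?_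
  have h : Q.coeff (fun μ => γ μ - α μ + r μ) ≠ 0 := fun e => hr (by simp [e, F.delPow_zero])
  have := hn _ h μ
  change r μ ≤ (n μ - γ μ + α μ).toNat
  simp only at this
  omega

/-- The product `∂₁^{α₁} ∂₂^{α₂} Q`. -/
def leftD (α : Fin 2 → ℤ) (Q : PDO F) : PDO F where
  coeff γ := ∑ᶠ r : Fin 2 → ℕ, (∏ μ, Ring.choose (α μ) (r μ)) •
      F.delPow r (Q.coeff (fun μ => γ μ - α μ + r μ))
  bdd := by
    obtain ⟨n, hn⟩ := Q.bdd
    refine ⟨α + n, fun γ h => ?_⟩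
    obtain ⟨r, hr⟩ := not_forall.1 (mt finsum_eq_zero_of_forall_eq_zero h)
    have h2 : Q.coeff (fun μ => γ μ - α μ + r μ) ≠ 0 := fun e => hr (by simp [e, F.delPow_zero])
    intro μ
    have h4 := hn _ h2 μ
    simp only [Pi.add_apply] at *
    omega

lemma coeff_leftD (α γ : Fin 2 → ℤ) (Q : PDO F) :
    (leftD α Q).coeff γ = ∑ᶠ r : Fin 2 → ℕ, (∏ μ, Ring.choose (α μ) (r μ)) •
      F.delPow r (Q.coeff (fun μ => γ μ - α μ + r μ)) := rfl

lemma leftD_le {α γ n : Fin 2 → ℤ} {Q : PDO F} (hn : ∀ β, Q.coeff β ≠ 0 → β ≤ n)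
    (h : (leftD α Q).coeff γ ≠ 0) : γ ≤ α + n := by
  obtain ⟨r, hr⟩ := not_forall.1 (mt finsum_eq_zero_of_forall_eq_zero h)
  have h2 : Q.coeff (fun μ => γ μ - α μ + r μ) ≠ 0 := fun e => hr (by simp [e, F.delPow_zero])
  intro μ
  have h4 := hn _ h2 μ
  simp only [Pi.add_apply] at *
  omega

lemma finite_mul (P Q : PDO F) (γ : Fin 2 → ℤ) :
    (Function.support fun α => P.coeff α * (leftD α Q).coeff γ).Finite := by
  obtain ⟨m, hm⟩ := P.bdd
  obtain ⟨n, hn⟩ := Q.bdd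
  refine (Set.finite_Icc (γ - n) m).subset fun α h => ⟨fun μ => ?_, hm α (left_ne_zero_of_mul h)⟩
  have := leftD_le hn (right_ne_zero_of_mul h) μ
  simp only [Pi.add_apply, Pi.sub_apply] at *
  omega

/-- The product in terms of left multiplication by powers of the derivations. -/
lemma coeff_mul (P Q : PDO F) (γ : Fin 2 → ℤ) :
    (P * Q).coeff γ = ∑ᶠ α, P.coeff α * (leftD α Q).coeff γ := by
  have hfin : (Function.support fun p : (Fin 2 → ℤ) × (Fin 2 → ℕ) =>
      (∏ μ, Ring.choose (p.1 μ) (p.2 μ)) •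
          (P.coeff p.1 * F.delPow p.2 (Q.coeff (fun μ => γ μ - p.1 μ + p.2 μ)))).Finite := by
    obtain ⟨m, hm⟩ := P.bdd
    obtain ⟨n, hn⟩ := Q.bdd
    refine ((Set.finite_Icc (γ - n) m).prod
      (Set.finite_Iic fun μ => (n μ - γ μ + m μ).toNat)).subset fun p hp => ?_
    have h1 : P.coeff p.1 ≠ 0 := fun e => hp (by simp [e])
    have h2 : Q.coeff (fun μ => γ μ - p.1 μ + p.2 μ) ≠ 0 := fun e =>
      hp (by simp [e, F.delPow_zero])
    refine ⟨⟨fun μ => ?_, hm _ h1⟩, fun μ => ?_⟩ <;>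
    · have h3 := hm _ h1 μ
      have h4 := hn _ h2 μ
      simp only [Pi.sub_apply] at *
      omega
  refine (finsum_curry _ hfin).trans (finsum_congr fun α => ?_)
  rw [coeff_leftD, mul_finsum' _ _ (finite_leftD α γ Q)]
  exact finsum_congr fun r => (mul_smul_comm _ _ _).symm

lemma leftD_zero (Q : PDO F) : leftD 0 Q = Q := by
  ext γ
  rw [coeff_leftD, finsum_eq_single _ (0 : Fin 2 → ℕ)]
  · simp [TimeDerivations.delPow]
  · intro r hr
    obtain ⟨μ, hμ⟩ := Function.ne_iff.1 hr
    rw [Finset.prod_eq_zero (Finset.mem_univ μ), zero_smul]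
    obtain ⟨k, hk⟩ := Nat.exists_eq_succ_of_ne_zero hμ
    rw [hk]
    exact Ring.choose_zero_succ ℤ k

lemma finsum_eq_finsum_add_single {M : Type*} [AddCommMonoid M] (ν : Fin 2)
    (g : (Fin 2 → ℕ) → M) (h : ∀ r, r ν = 0 → g r = 0) :
    ∑ᶠ r, g r = ∑ᶠ r, g (r + (Pi.single ν 1 : Fin 2 → ℕ)) := by
  have hinj : Function.Injective fun r : Fin 2 → ℕ => r + (Pi.single ν 1 : Fin 2 → ℕ) :=
    add_left_injective _
  rw [← finsum_mem_range (f := g) hinj, ← finsum_mem_univ g]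
  refine finsum_mem_inter_support_eq' _ _ _ fun r hr => ⟨fun _ => ?_, fun _ => trivial⟩
  refine ⟨r - Pi.single ν 1, ?_⟩
  have : r ν ≠ 0 := fun e => hr (h r e)
  funext μ
  by_cases e : μ = ν
  · subst e; simp; omega
  · simp [Pi.single_eq_of_ne e]

lemma prod_choose_succ (α : Fin 2 → ℤ) (r : Fin 2 → ℕ) (ν : Fin 2) :
    ∏ μ, Ring.choose ((α + Pi.single ν 1 : Fin 2 → ℤ) μ) ((r + Pi.single ν 1 : Fin 2 → ℕ) μ) =
      ∏ μ, Ring.choose (α μ) (r μ) + ∏ μ, Ring.choose (α μ) ((r + Pi.single ν 1 : Fin 2 → ℕ) μ) := by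
  fin_cases ν <;> simp [Fin.prod_univ_two, Ring.choose_succ_succ] <;> ring

lemma prod_choose_of_eq_zero (α : Fin 2 → ℤ) (r : Fin 2 → ℕ) (ν : Fin 2) (h : r ν = 0) :
    ∏ μ, Ring.choose ((α + Pi.single ν 1 : Fin 2 → ℤ) μ) (r μ) = ∏ μ, Ring.choose (α μ) (r μ) := by
  refine Finset.prod_congr rfl fun μ _ => ?_
  by_cases e : μ = ν
  · subst e; simp [h]
  · simp [Pi.single_eq_of_ne e]

/-- The rule `∂_ν f = f ∂_ν + ∂_ν(f)`, from Pascal's rule for the binomial coefficients. -/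
lemma coeff_leftD_add_single (α γ : Fin 2 → ℤ) (ν : Fin 2) (Q : PDO F) :
    (leftD (α + Pi.single ν 1) Q).coeff γ =
      F.D (ν, 1) ((leftD α Q).coeff γ) + (leftD α Q).coeff (γ - Pi.single ν 1) := by
  set X : (Fin 2 → ℕ) → A := fun r =>
    F.delPow r (Q.coeff (fun μ => γ μ - (α + Pi.single ν 1 : Fin 2 → ℤ) μ + r μ)) with hX
  have f1 := finite_leftD (α + Pi.single ν 1) γ Q
  have f2 : (Function.support fun r => (∏ μ, Ring.choose (α μ) (r μ)) • X r).Finite := by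
    convert finite_leftD α (γ - Pi.single ν 1) Q using 7
    simp only [Pi.add_apply, Pi.sub_apply]
    omega
  have e2 : (leftD α Q).coeff (γ - Pi.single ν 1) =
      ∑ᶠ r, (∏ μ, Ring.choose (α μ) (r μ)) • X r := by
    rw [coeff_leftD]
    refine finsum_congr fun r => ?_
    rw [hX]
    congr 3
    funext μ
    simp only [Pi.add_apply, Pi.sub_apply]
    omega
  rw [e2, ← sub_eq_iff_eq_add, coeff_leftD, ← finsum_sub_distrib f1 f2,
    finsum_eq_finsum_add_single ν]
  · rw [coeff_leftD, ← AddMonoidHom.coe_coe (F.D (ν, 1)),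
      AddMonoidHom.map_finsum _ (finite_leftD α γ Q)]
    refine finsum_congr fun r => ?_
    rw [prod_choose_succ, add_smul, hX]
    simp only [add_sub_cancel_right, AddMonoidHom.coe_coe, map_zsmul, F.delPow_add_single]
    congr 5
    funext μ
    by_cases e : μ = ν
    · subst e; simp; ring
    · simp [Pi.single_eq_of_ne e]
  · intro r hr
    rw [prod_choose_of_eq_zero _ _ _ hr, sub_self]

lemma coeff_leftD_single (γ : Fin 2 → ℤ) (ν : Fin 2) (Q : PDO F) :
    (leftD (Pi.single ν 1) Q).coeff γ =
      F.D (ν, 1) (Q.coeff γ) + Q.coeff (γ - Pi.single ν 1) := by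
  have := coeff_leftD_add_single 0 γ ν Q
  rwa [zero_add, leftD_zero] at this

lemma leftD_add_single (α : Fin 2 → ℤ) (ν : Fin 2) (Q : PDO F) :
    leftD (α + Pi.single ν 1) Q = leftD (Pi.single ν 1) (leftD α Q) := by
  ext γ
  rw [coeff_leftD_add_single, coeff_leftD_single]

lemma leftD_single_mul (ν : Fin 2) (Q R : PDO F) :
    leftD (Pi.single ν 1) (Q * R) = leftD (Pi.single ν 1) Q * R := by
  ext γ
  have f0 : ∀ δ, (Function.support fun β => Q.coeff β * (leftD β R).coeff δ).Finite :=
    fun δ => finite_mul Q R δ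
  have f1 : (Function.support fun β =>
      F.D (ν, 1) (Q.coeff β) * (leftD β R).coeff γ).Finite :=
    finite_mul (dt (ν, 1) Q) R γ
  have f2 : (Function.support fun β =>
      Q.coeff β * F.D (ν, 1) ((leftD β R).coeff γ)).Finite :=
    (f0 γ |>.union f1).subset fun β hβ => by
      by_contra h
      simp only [Set.mem_union, Function.mem_support, not_or, not_not] at h
      have h3 := congrArg (F.D (ν, 1)) h.1
      rw [Derivation.leibniz, map_zero, smul_eq_mul, smul_eq_mul,
        mul_comm _ (F.D _ (Q.coeff β)), h.2, add_zero] at h3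
      exact hβ h3
  have f3 : (Function.support fun β =>
      Q.coeff (β - Pi.single ν 1) * (leftD β R).coeff γ).Finite := by
    refine ((f2.union (f0 (γ - Pi.single ν 1))).preimage
      (sub_left_injective (b := (Pi.single ν 1 : Fin 2 → ℤ))).injOn).subset fun β hβ => ?_
    by_contra h
    simp only [Set.mem_preimage, Set.mem_union, Function.mem_support, not_or, not_not] at h
    apply hβ
    obtain ⟨β, rfl⟩ : ∃ β', β = β' + Pi.single ν 1 := ⟨β - Pi.single ν 1, by simp⟩
    rw [add_sub_cancel_right] at h
    simp only [add_sub_cancel_right]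
    rw [coeff_leftD_add_single, mul_add, h.1, h.2, add_zero]
  rw [coeff_leftD_single, coeff_mul, coeff_mul, coeff_mul, ← AddMonoidHom.coe_coe (F.D (ν, 1)),
    AddMonoidHom.map_finsum _ (f0 γ)]
  have e : ∀ β, (leftD (Pi.single ν 1) Q).coeff β * (leftD β R).coeff γ =
      F.D (ν, 1) (Q.coeff β) * (leftD β R).coeff γ +
        Q.coeff (β - Pi.single ν 1) * (leftD β R).coeff γ := fun β => by
    rw [coeff_leftD_single, add_mul]
  have e3 : ∑ᶠ β, Q.coeff (β - Pi.single ν 1) * (leftD β R).coeff γ =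
      ∑ᶠ β, Q.coeff β * (leftD (β + Pi.single ν 1) R).coeff γ := by
    refine (finsum_comp_equiv (Equiv.addRight (Pi.single ν 1 : Fin 2 → ℤ))).symm.trans ?_
    simp only [Equiv.coe_addRight, add_sub_cancel_right]
  rw [finsum_congr e, finsum_add_distrib f1 f3, e3]
  simp only [coeff_leftD_add_single, mul_add,
    AddMonoidHom.coe_coe, Derivation.leibniz, smul_eq_mul]
  rw [finsum_add_distrib f2 (f0 _), finsum_add_distrib f2 (by simpa only [mul_comm, Function.HasFiniteSupport] using f1)]
  simp only [mul_comm ((leftD _ R).coeff γ)]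
  ring

/-- The coefficients of `Q` are recovered from those of `∂_ν Q` by a descending recursion, which starts
above the order of `Q`. -/
lemma leftD_single_injective (ν : Fin 2) :
    Function.Injective (leftD (F := F) (Pi.single ν 1)) := by
  intro Q Q' h
  have key : ∀ n : ℕ, ∀ γ : Fin 2 → ℤ, (∀ m : Fin 2 → ℤ, (∀ β, Q.coeff β ≠ 0 → β ≤ m) →
      (∀ β, Q'.coeff β ≠ 0 → β ≤ m) → m ν < γ ν + n → Q.coeff γ = Q'.coeff γ) := by
    intro n
    induction n with
    | zero =>
      intro γ m h1 h2 h3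
      have h4 : ¬ γ ≤ m := fun h => by have h5 : γ ν ≤ m ν := h ν; simp at h3; omega
      rw [not_imp_comm.1 (h1 γ) h4, not_imp_comm.1 (h2 γ) h4]
    | succ n ih =>
      intro γ m h1 h2 h3
      have h4 := ih (γ + Pi.single ν 1) m h1 h2 (by simp at h3 ⊢; omega)
      have h5 := congrArg (fun P : PDO F => P.coeff (γ + Pi.single ν 1)) h
      simpa [coeff_leftD_single, h4] using h5
  ext γ
  obtain ⟨m, hm⟩ := Q.bdd
  obtain ⟨m', hm'⟩ := Q'.bdd
  exact key ((m ⊔ m') ν - γ ν + 1).toNat γ (m ⊔ m') (fun β hβ => (hm β hβ).trans le_sup_left)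
    (fun β hβ => (hm' β hβ).trans le_sup_right) (by omega)

lemma pi_int_induction {p : (Fin 2 → ℤ) → Prop} (zero : p 0)
    (succ : ∀ α ν, p α → p (α + Pi.single ν 1)) (pred : ∀ α ν, p (α + Pi.single ν 1) → p α)
    (α : Fin 2 → ℤ) : p α := by
  have step : ∀ ν α, p α → ∀ n : ℤ, p (α + Pi.single ν n) := by
    intro ν α hα n
    induction n using Int.induction_on with
    | zero => simpa using hα
    | succ n ih => rw [Pi.single_add, ← add_assoc]; exact succ _ _ ih
    | pred n ih =>
      refine pred _ ν ?_
      rw [add_assoc, ← Pi.single_add, sub_add_cancel]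
      exact ih
  have h := step 1 _ (step 0 0 zero (α 0)) (α 1)
  convert h using 1
  funext μ
  fin_cases μ <;> simp

/-- Associativity for a left factor `∂₁^{α₁} ∂₂^{α₂}`; the step to negative exponents cancels a factor
`∂_ν`. -/
lemma leftD_mul (α : Fin 2 → ℤ) (Q R : PDO F) : leftD α (Q * R) = leftD α Q * R := by
  induction α using pi_int_induction with
  | zero => rw [leftD_zero, leftD_zero]
  | succ α ν ih => rw [leftD_add_single, ih, leftD_single_mul, ← leftD_add_single]
  | pred α ν ih =>
    apply leftD_single_injective ν
    rw [← leftD_add_single, ih, leftD_single_mul, ← leftD_add_single]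

lemma finsum_swap {ι κ M : Type*} [AddCommMonoid M] (f : ι → κ → M) (h : (Function.support fun p : ι × κ =>
    f p.1 p.2).Finite) : ∑ᶠ i, ∑ᶠ j, f i j = ∑ᶠ j, ∑ᶠ i, f i j := by
  have h' : (Function.support fun p : κ × ι => f p.2 p.1).Finite :=
    (h.preimage (Equiv.prodComm κ ι).injective.injOn)
  rw [← finsum_curry (fun p : ι × κ => f p.1 p.2) h, ← finsum_curry (fun p : κ × ι => f p.2 p.1) h',
    ← finsum_comp_equiv (Equiv.prodComm κ ι)]
  rfl

protected lemma mul_assoc (P Q R : PDO F) : P * Q * R = P * (Q * R) := by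
  ext γ
  rw [coeff_mul, coeff_mul]
  have hfin : (Function.support fun p : (Fin 2 → ℤ) × (Fin 2 → ℤ) =>
      P.coeff p.2 * (leftD p.2 Q).coeff p.1 * (leftD p.1 R).coeff γ).Finite := by
    obtain ⟨m, hm⟩ := P.bdd
    obtain ⟨n, hn⟩ := Q.bdd
    obtain ⟨l, hl⟩ := R.bdd
    refine ((Set.finite_Icc (γ - l) (m + n)).prod (Set.finite_Icc (γ - l - n) m)).subset
      fun p hp => ?_
    have h1 := hm _ (left_ne_zero_of_mul (left_ne_zero_of_mul hp))
    have h2 := leftD_le hn (right_ne_zero_of_mul (left_ne_zero_of_mul hp))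
    have h3 := leftD_le hl (right_ne_zero_of_mul hp)
    refine ⟨⟨fun μ => ?_, fun μ => ?_⟩, fun μ => ?_, h1⟩ <;>
    · have := h1 μ
      have := h2 μ
      have := h3 μ
      simp only [Pi.add_apply, Pi.sub_apply] at *
      omega
  have e1 : ∀ β, (P * Q).coeff β * (leftD β R).coeff γ =
      ∑ᶠ α, P.coeff α * (leftD α Q).coeff β * (leftD β R).coeff γ := fun β => by
    rw [coeff_mul, finsum_mul' _ _ (finite_mul P Q β)]
  have e2 : ∀ α, P.coeff α * (leftD α (Q * R)).coeff γ =
      ∑ᶠ β, P.coeff α * (leftD α Q).coeff β * (leftD β R).coeff γ := fun α => by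
    rw [leftD_mul, coeff_mul, mul_finsum' _ _ (finite_mul _ R γ)]
    simp only [mul_assoc]
  rw [finsum_congr e1, finsum_congr e2]
  exact finsum_swap _ hfin

lemma coeff_monomial_mul (α γ : Fin 2 → ℤ) (f : A) (Q : PDO F) :
    (monomial F α f * Q).coeff γ = f * (leftD α Q).coeff γ := by
  rw [coeff_mul, finsum_eq_single _ α]
  · simp [coeff_monomial]
  · intro β hβ
    simp [coeff_monomial, Pi.single_eq_of_ne hβ]

lemma monomial_one_mul (α : Fin 2 → ℤ) (Q : PDO F) : monomial F α 1 * Q = leftD α Q := by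
  ext γ
  rw [coeff_monomial_mul, one_mul]

lemma delPow_one {r : Fin 2 → ℕ} (hr : r ≠ 0) : F.delPow r 1 = 0 := by
  have h : ∃ (ν : Fin 2) (s : Fin 2 → ℕ), r = s + Pi.single ν 1 := by
    obtain ⟨ν, hν⟩ := Function.ne_iff.1 hr
    refine ⟨ν, r - Pi.single ν 1, ?_⟩
    funext μ
    by_cases e : μ = ν
    · subst e; simp at hν ⊢; omega
    · simp [Pi.single_eq_of_ne e]
  obtain ⟨ν, s, rfl⟩ := h
  have hz : ∀ s : Fin 2 → ℕ, F.D (ν, 1) (F.delPow s 1) = F.delPow s (F.D (ν, 1) 1) := by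
    intro s
    have hc : ∀ μ n f, F.D (ν, 1) ((F.del μ)^[n] f) = (F.del μ)^[n] (F.D (ν, 1) f) := by
      intro μ n f
      have h : Function.Commute (F.D (ν, 1)) (F.del μ) := fun f => F.comm _ _ f
      exact (h.iterate_right n) f
    rw [TimeDerivations.delPow, hc, hc, TimeDerivations.delPow]
  rw [F.delPow_add_single, hz, Derivation.map_one_eq_zero, F.delPow_zero]

lemma leftD_monomial_one (α β : Fin 2 → ℤ) :
    leftD α (monomial F β 1) = monomial F (α + β) 1 := by
  ext γ
  rw [coeff_leftD, finsum_eq_single _ (0 : Fin 2 → ℕ)]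
  · have : (fun μ => γ μ - α μ + ((0 : Fin 2 → ℕ) μ : ℤ)) = γ - α := by funext μ; simp
    rw [this]
    simp only [Pi.zero_apply, Ring.choose_zero_right, Finset.prod_const_one, one_smul,
      TimeDerivations.delPow, Function.iterate_zero, id_eq, coeff_monomial, Pi.single_apply,
      sub_eq_iff_eq_add, add_comm β]
  · intro r hr
    rw [coeff_monomial, Pi.single_apply]
    split_ifs
    · rw [delPow_one hr, smul_zero]
    · rw [F.delPow_zero, smul_zero]

protected lemma one_mul (P : PDO F) : 1 * P = P := (monomial_one_mul 0 P).trans (leftD_zero P)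

protected lemma mul_one (P : PDO F) : P * 1 = P := by
  ext γ
  have h : ∀ α, leftD α (1 : PDO F) = monomial F α 1 := fun α =>
    (leftD_monomial_one α 0).trans (by rw [add_zero])
  rw [coeff_mul, finsum_eq_single _ γ]
  · simp [h, coeff_monomial]
  · intro α hα
    simp [h, coeff_monomial, Pi.single_eq_of_ne hα.symm]

instance : Ring (PDO F) where
  zsmul := zsmulRec
  nsmul := nsmulRec
  neg_add_cancel := neg_add_cancel
  left_distrib P Q R := by
    ext γ
    have h : ∀ α, leftD α (Q + R) = leftD α Q + leftD α R := fun α => by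
      ext γ
      simp only [coeff_add, coeff_leftD, F.delPow_add, smul_add]
      exact finsum_add_distrib (finite_leftD α γ Q) (finite_leftD α γ R)
    simp only [coeff_add, coeff_mul, h, mul_add]
    exact finsum_add_distrib (finite_mul P Q γ) (finite_mul P R γ)
  right_distrib P Q R := by
    ext γ
    simp only [coeff_add, coeff_mul, add_mul]
    exact finsum_add_distrib (finite_mul P R γ) (finite_mul Q R γ)
  zero_mul P := by ext γ; simp [coeff_mul]
  mul_zero P := by
    ext γ
    have h : ∀ α, leftD α (0 : PDO F) = 0 := fun α => by
      ext γ; simp [coeff_leftD, F.delPow_zero]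
    simp [coeff_mul, h]
  mul_assoc := PDO.mul_assoc
  one_mul := PDO.one_mul
  mul_one := PDO.mul_one
  npow k P := P ^ k
  npow_zero P := rfl
  npow_succ k P := by
    induction k with
    | zero => exact (PDO.mul_one P).trans (PDO.one_mul P).symm
    | succ k ih =>
      have h : ∀ k : ℕ, (P ^ (k + 1) : PDO F) = P * P ^ k := fun k =>
        Function.iterate_succ_apply' _ _ _
      rw [h, ih, ← PDO.mul_assoc, ← h, ih]

end PDO

end

section

variable {A : Type*} [CommRing A] [Algebra ℂ A]
namespace PDO
variable {F : TimeDerivations A}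

/-! ### Operators in a single derivation -/

/-- `P` has the form `∑_{i ≤ n} f_i ∂_ν^i`: only the derivation `∂_ν` occurs, and the order is at
most `n`. -/
def OrdLE (ν : Fin 2) (n : ℤ) (P : PDO F) : Prop :=
  ∀ α, P.coeff α ≠ 0 → α = Pi.single ν (α ν) ∧ α ν ≤ n

namespace OrdLE
variable {ν : Fin 2} {m n : ℤ} {P Q : PDO F}

lemma mono (h : OrdLE ν m P) (hmn : m ≤ n) : OrdLE ν n P :=
  fun α hα => ⟨(h α hα).1, (h α hα).2.trans hmn⟩

lemma coeff_eq_zero (h : OrdLE ν m P) (hn : m < n) : P.coeff (Pi.single ν n) = 0 := by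
  by_contra hne
  have := (h _ hne).2
  rw [Pi.single_eq_same] at this
  omega

lemma add (hP : OrdLE ν n P) (hQ : OrdLE ν n Q) : OrdLE ν n (P + Q) := fun α hα => by
  by_cases h : P.coeff α = 0
  · exact hQ α fun e => hα (by simp [h, e])
  · exact hP α h

lemma neg (hP : OrdLE ν n P) : OrdLE ν n (-P) := fun α hα => hP α fun e => hα (by simp [e])

lemma sub (hP : OrdLE ν n P) (hQ : OrdLE ν n Q) : OrdLE ν n (P - Q) :=
  sub_eq_add_neg P Q ▸ hP.add hQ.neg

lemma mul (hP : OrdLE ν m P) (hQ : OrdLE ν n Q) : OrdLE ν (m + n) (P * Q) := fun γ hγ => by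
  rw [coeff_mul] at hγ
  obtain ⟨α, hα⟩ := not_forall.1 (mt finsum_eq_zero_of_forall_eq_zero hγ)
  obtain ⟨h1, h1'⟩ := hP α (left_ne_zero_of_mul hα)
  obtain ⟨r, hr⟩ := not_forall.1 (mt finsum_eq_zero_of_forall_eq_zero (right_ne_zero_of_mul hα))
  obtain ⟨h2, h2'⟩ := hQ _ fun e => hr (by rw [e, F.delPow_zero, smul_zero])
  have h3 : ∏ μ, Ring.choose (α μ) (r μ) ≠ 0 := fun e => hr (by rw [e, zero_smul])
  refine ⟨?_, by omega⟩
  funext μ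
  by_cases e : μ = ν
  · subst e; simp
  · have h4 := congrFun h1 μ
    have h5 := congrFun h2 μ
    have h6 := Finset.prod_ne_zero_iff.1 h3 μ (Finset.mem_univ μ)
    rw [Pi.single_eq_of_ne e] at h4 h5 ⊢
    rw [h4] at h6
    have h7 : r μ = 0 := by
      by_contra h
      obtain ⟨k, hk⟩ := Nat.exists_eq_succ_of_ne_zero h
      rw [hk] at h6
      exact h6 (Ring.choose_zero_succ ℤ k)
    omega

lemma zero : OrdLE ν n (0 : PDO F) := fun _ h => absurd rfl h

lemma sum {ι : Type*} (s : Finset ι) (f : ι → PDO F) (h : ∀ i ∈ s, OrdLE ν n (f i)) :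
    OrdLE ν n (∑ i ∈ s, f i) := by
  classical
  induction s using Finset.induction_on with
  | empty => exact zero
  | insert a s ha ih =>
    rw [Finset.sum_insert ha]
    exact (h a (Finset.mem_insert_self a s)).add
      (ih fun i hi => h i (Finset.mem_insert_of_mem hi))

lemma dt (hP : OrdLE ν n P) (i : Time) : OrdLE ν n (dt i P) :=
  fun α hα => hP α fun e => hα (by simp [PDO.dt, e])

end OrdLE

variable {ν : Fin 2} {m n : ℤ} {P Q : PDO F}

lemma ordLE_monomial (ν : Fin 2) (n : ℤ) (f : A) : OrdLE ν n (monomial F (Pi.single ν n) f) :=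
  fun α hα => by
    have : α = Pi.single ν n := by
      by_contra h
      exact hα (Pi.single_eq_of_ne h _)
    subst this
    simp

lemma ordLE_dpow (ν : Fin 2) (n : ℤ) : OrdLE ν n (dpow F ν n) := ordLE_monomial ν n 1

lemma ordLE_fn (ν : Fin 2) (f : A) : OrdLE ν 0 (fn F f) := by
  have := ordLE_monomial (F := F) ν 0 f
  rwa [Pi.single_zero] at this

lemma ordLE_one (ν : Fin 2) : OrdLE ν 0 (1 : PDO F) := ordLE_fn ν 1

lemma OrdLE.pow {P : PDO F} (h : OrdLE ν n P) (k : ℕ) : OrdLE ν (k * n) (P ^ k) := by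
  induction k with
  | zero => simpa using ordLE_one ν
  | succ k ih =>
    rw [pow_succ]
    exact (ih.mul h).mono (by push_cast; linarith)

lemma ordLE_dressing (ν : Fin 2) (u : A) (a : ℕ → A) : OrdLE ν 0 (dressing F ν u a) :=
  fun α hα => by
    by_contra h
    exact hα (if_neg h)

lemma coeff_dressing (ν : Fin 2) (u : A) (a : ℕ → A) (n : ℤ) :
    (dressing F ν u a).coeff (Pi.single ν n) =
      if n ≤ 0 then (if n = 0 then u else u * a (-n).toNat) else 0 := by
  simp [dressing]

lemma coeff_fn_mul (f : A) (P : PDO F) (γ) : (fn F f * P).coeff γ = f * P.coeff γ := by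
  rw [fn, coeff_monomial_mul, leftD_zero]

lemma coeff_dpow_one_mul (ν : Fin 2) (P : PDO F) (γ) :
    (dpow F ν 1 * P).coeff γ = F.D (ν, 1) (P.coeff γ) + P.coeff (γ - Pi.single ν 1) := by
  rw [dpow, monomial_one_mul, coeff_leftD_single]

lemma dpow_mul_dpow (ν : Fin 2) (m n : ℤ) : dpow F ν m * dpow F ν n = dpow F ν (m + n) := by
  rw [dpow, dpow, monomial_one_mul, leftD_monomial_one, ← Pi.single_add, dpow]

lemma dpow_zero (ν : Fin 2) : dpow F ν 0 = 1 := by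
  rw [dpow, Pi.single_zero]; rfl

lemma dpow_comm (μ ν : Fin 2) (m n : ℤ) : dpow F μ m * dpow F ν n = dpow F ν n * dpow F μ m := by
  simp only [dpow, monomial_one_mul, leftD_monomial_one, add_comm]

lemma coeff_mul_dpow (ν : Fin 2) (n : ℤ) (P : PDO F) (γ) :
    (P * dpow F ν n).coeff γ = P.coeff (γ - Pi.single ν n) := by
  rw [coeff_mul, finsum_eq_single _ (γ - Pi.single ν n)]
  · simp [dpow, leftD_monomial_one, coeff_monomial]
  · intro α hα
    rw [dpow, leftD_monomial_one, coeff_monomial, Pi.single_eq_of_ne, mul_zero]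
    intro e
    exact hα (by rw [e]; simp)

/-- The rule `∂_ν P = P ∂_ν + ∂_ν⟨P⟩`. -/
lemma dpow_one_mul (ν : Fin 2) (P : PDO F) :
    dpow F ν 1 * P = P * dpow F ν 1 + dt (ν, 1) P := by
  ext γ
  rw [coeff_dpow_one_mul, coeff_add, coeff_mul_dpow, add_comm]
  rfl

lemma fn_mul_fn (f g : A) : fn F f * fn F g = fn F (f * g) := by
  ext γ
  rw [coeff_fn_mul, fn, fn, coeff_monomial, coeff_monomial, Pi.single_apply, Pi.single_apply,
    mul_ite, mul_zero]

lemma fn_one : fn F (1 : A) = 1 := rfl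

/-- Left multiplication by `∂_ν^m` does not change the leading coefficient. -/
lemma OrdLE.coeff_dpow_mul (hQ : OrdLE ν n Q) (m : ℤ) :
    (dpow F ν m * Q).coeff (Pi.single ν (m + n)) = Q.coeff (Pi.single ν n) := by
  rw [dpow, monomial_one_mul, coeff_leftD, finsum_eq_single _ 0]
  · have : (fun μ => (Pi.single ν (m + n) : Fin 2 → ℤ) μ - (Pi.single ν m : Fin 2 → ℤ) μ
        + ((0 : Fin 2 → ℕ) μ : ℤ)) = Pi.single ν n := by
      funext μ
      by_cases e : μ = ν
      · subst e; simp
      · simp [Pi.single_eq_of_ne e]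
    rw [this]
    simp [TimeDerivations.delPow]
  · intro r hr
    by_contra h
    obtain ⟨h1, h2⟩ := hQ _ fun e => h (by rw [e, F.delPow_zero, smul_zero])
    apply hr
    funext μ
    by_cases e : μ = ν
    · subst e; simp at h2 ⊢; omega
    · have := congrFun h1 μ
      simp [Pi.single_eq_of_ne e] at this
      simpa using this

lemma OrdLE.coeff_zero_mul (hP : OrdLE ν 0 P) (hQ : OrdLE ν 0 Q) :
    (P * Q).coeff 0 = P.coeff 0 * Q.coeff 0 := by
  rw [coeff_mul, finsum_eq_single _ 0, leftD_zero]
  intro α hα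
  by_contra h
  obtain ⟨h1, h2⟩ := hP α (left_ne_zero_of_mul h)
  obtain ⟨r, hr⟩ := not_forall.1 (mt finsum_eq_zero_of_forall_eq_zero (right_ne_zero_of_mul h))
  have h3 := (hQ _ fun e => hr (by rw [e, F.delPow_zero, smul_zero])).2
  simp only [Pi.zero_apply] at h3
  have h4 : α ν = 0 := by omega
  rw [h4, Pi.single_zero] at h1
  exact hα h1

/-! ### Inverses and Lax operators -/

lemma eq_zero_of_ordLE (h : ∀ N : ℕ, OrdLE ν (-N) P) : P = 0 := by
  ext α
  by_contra hα
  have := (h (1 - α ν).toNat α hα).2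
  omega

/-- The sum of the geometric series `∑ K^j` of an operator of negative order. -/
def geomSum {K : PDO F} (hK : OrdLE ν (-1) K) : PDO F where
  coeff α := ∑ j ∈ Finset.range ((-α ν).toNat + 1), (K ^ j).coeff α
  bdd := ⟨0, fun α h => by
    obtain ⟨j, -, hj⟩ := Finset.exists_ne_zero_of_sum_ne_zero h
    obtain ⟨h1, h2⟩ := hK.pow j α hj
    rw [h1]
    intro μ
    by_cases e : μ = ν
    · subst e; simp; omega
    · simp [Pi.single_eq_of_ne e]⟩

lemma ordLE_geomSum_sub {K : PDO F} (hK : OrdLE ν (-1) K) (N : ℕ) :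
    OrdLE ν (-N) (geomSum hK - ∑ j ∈ Finset.range N, K ^ j) := fun α hα => by
  rw [coeff_sub, coeff_sum] at hα
  have hz : ∀ j : ℕ, (-α ν) < j → (K ^ j).coeff α = 0 := fun j hj => by
    by_contra h
    have := (hK.pow j α h).2
    omega
  constructor
  · by_contra h
    apply hα
    have hz : ∀ j : ℕ, (K ^ j).coeff α = 0 := fun j => by
      by_contra h'
      exact h (hK.pow j α h').1
    simp [geomSum, hz]
  · by_contra h
    apply hα
    rw [sub_eq_zero]
    by_cases h0 : 0 ≤ -α ν
    · refine Finset.sum_subset (Finset.range_subset_range.2 (by omega)) fun j _ hj => hz j ?_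
      simp at hj
      omega
    · rw [Finset.sum_eq_zero fun j _ => hz j (by omega)]
      exact Finset.sum_eq_zero (s := Finset.range ((-α ν).toNat + 1)) fun j _ => hz j (by omega)

lemma one_sub_mul_geomSum {K : PDO F} (hK : OrdLE ν (-1) K) : (1 - K) * geomSum hK = 1 := by
  rw [← sub_eq_zero]
  refine eq_zero_of_ordLE (ν := ν) fun N => ?_
  have e : (1 - K) * geomSum hK - 1 =
      (1 - K) * (geomSum hK - ∑ j ∈ Finset.range N, K ^ j) - K ^ N := by
    rw [mul_sub, mul_neg_geom_sum]; abel
  rw [e]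
  refine OrdLE.sub ?_ ((hK.pow N).mono (by omega))
  exact (((ordLE_one ν).sub (hK.mono (by omega))).mul (ordLE_geomSum_sub hK N)).mono (by omega)

lemma geomSum_mul_one_sub {K : PDO F} (hK : OrdLE ν (-1) K) : geomSum hK * (1 - K) = 1 := by
  rw [← sub_eq_zero]
  refine eq_zero_of_ordLE (ν := ν) fun N => ?_
  have e : geomSum hK * (1 - K) - 1 =
      (geomSum hK - ∑ j ∈ Finset.range N, K ^ j) * (1 - K) - K ^ N := by
    rw [sub_mul, geom_sum_mul_neg]; abel
  rw [e]
  refine OrdLE.sub ?_ ((hK.pow N).mono (by omega))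
  exact ((ordLE_geomSum_sub hK N).mul ((ordLE_one ν).sub (hK.mono (by omega)))).mono (by omega)

lemma inv_eq_of_mul_eq_one (h1 : P * Q = 1) (h2 : Q * P = 1) : P⁻¹ = Q := by
  have h : ∃ Q : PDO F, P * Q = 1 ∧ Q * P = 1 := ⟨Q, h1, h2⟩
  have e : P⁻¹ = h.choose := dif_pos h
  rw [e]
  exact left_inv_eq_right_inv h.choose_spec.2 h1

/-- An operator of order zero in one derivation, whose leading coefficient is invertible, has an
inverse of the same kind, given by a geometric series. -/
lemma OrdLE.exists_inverse (hP : OrdLE ν 0 P) (u : Aˣ) (hu : P.coeff 0 = u) :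
    OrdLE ν 0 P⁻¹ ∧ P * P⁻¹ = 1 ∧ P⁻¹ * P = 1 := by
  set v : PDO F := fn F ((u⁻¹ : Aˣ) : A)
  set K : PDO F := 1 - v * P with hKdef
  have hvP : OrdLE ν 0 (v * P) := ((ordLE_fn ν _).mul hP)
  have hK : OrdLE ν (-1) K := fun α hα => by
    obtain ⟨h1, h2⟩ := (ordLE_one ν).sub hvP α hα
    refine ⟨h1, ?_⟩
    by_contra h
    have h3 : α ν = 0 := by omega
    rw [h3, Pi.single_zero] at h1
    subst h1
    apply hα
    rw [hKdef, coeff_sub, coeff_fn_mul, hu, Units.inv_mul, coeff_one, Pi.single_eq_same, sub_self]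
  have e : v * P = 1 - K := by rw [hKdef]; abel
  have h1 : geomSum hK * v * P = 1 := by rw [mul_assoc, e, geomSum_mul_one_sub]
  have h2 : P * (geomSum hK * v) = 1 := by
    have h3 : fn F (u : A) * v = 1 := by rw [fn_mul_fn, Units.mul_inv, fn_one]
    have h4 : P = fn F (u : A) * (1 - K) := by rw [← e, ← mul_assoc, h3, one_mul]
    rw [h4, mul_assoc, ← mul_assoc (1 - K), one_sub_mul_geomSum, one_mul, h3]
  rw [inv_eq_of_mul_eq_one h2 h1]
  refine ⟨?_, h2, h1⟩
  have := (ordLE_geomSum_sub hK 0)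
  simp only [Finset.range_zero, Finset.sum_empty, sub_zero, Nat.cast_zero, neg_zero] at this
  exact this.mul (ordLE_fn ν _)

lemma lax_pow (h : P⁻¹ * P = 1) (h' : P * P⁻¹ = 1) (k : ℕ) :
    lax ν P ^ k = P * dpow F ν k * P⁻¹ := by
  induction k with
  | zero => rw [pow_zero, Nat.cast_zero, dpow_zero, mul_one, h']
  | succ k ih =>
    rw [pow_succ, ih, lax]
    calc P * dpow F ν k * P⁻¹ * (P * dpow F ν 1 * P⁻¹)
        = P * dpow F ν k * (P⁻¹ * P) * dpow F ν 1 * P⁻¹ := by simp only [mul_assoc]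
      _ = _ := by rw [h, mul_one, mul_assoc P, dpow_mul_dpow]; simp

/-! ### Symbols and residues -/

@[simp] lemma coeff_ampPos (ν : Fin 2) (P : PDO F) (n : ℤ) :
    (ampPos ν P).coeff n = P.coeff (Pi.single ν (-n)) := rfl

@[simp] lemma coeff_ampNeg (ν : Fin 2) (P : PDO F) (n : ℤ) :
    (ampNeg ν P).coeff n = (Int.negOnePow n : ℤ) • P.coeff (Pi.single ν (-n)) := rfl

lemma ampPos_add (ν : Fin 2) (P Q : PDO F) : ampPos ν (P + Q) = ampPos ν P + ampPos ν Q := rfl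

lemma OrdLE.ext_ampPos (hP : OrdLE ν m P) (hQ : OrdLE ν n Q) (h : ampPos ν P = ampPos ν Q) :
    P = Q := by
  ext α
  by_cases hα : α = Pi.single ν (α ν)
  · have := congrArg (fun L => HahnSeries.coeff L (-(α ν))) h
    simp only [coeff_ampPos, neg_neg] at this
    rwa [← hα] at this
  · rw [not_imp_comm.1 (hP α) fun h => hα h.1, not_imp_comm.1 (hQ α) fun h => hα h.1]

lemma _root_.HahnSeries.coeff_mul_eq_finsum {R : Type*} [CommRing R] (x y : LaurentSeries R)
    (n : ℤ) : (x * y).coeff n = ∑ᶠ i, x.coeff i * y.coeff (n - i) := by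
  rw [HahnSeries.coeff_mul]
  have hinj : Set.InjOn (Prod.fst : ℤ × ℤ → ℤ)
      (Finset.antidiagonal x.isPWO_support y.isPWO_support n : Set (ℤ × ℤ)) := by
    intro p hp q hq h
    simp only [Finset.mem_coe, Finset.mem_antidiagonal] at hp hq
    ext
    · exact h
    · have := hp.2.2.trans hq.2.2.symm
      rw [h] at this
      exact add_left_cancel this
  rw [finsum_eq_sum_of_support_subset (s :=
    (Finset.antidiagonal x.isPWO_support y.isPWO_support n).image Prod.fst)]
  · rw [Finset.sum_image hinj]
    refine Finset.sum_congr rfl fun p hp => ?_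
    rw [← (Finset.mem_antidiagonal.1 hp).2.2, add_sub_cancel_left]
  · intro i hi
    simp only [Finset.coe_image, Set.mem_image, Finset.mem_coe, Finset.mem_antidiagonal]
    exact ⟨(i, n - i), ⟨left_ne_zero_of_mul hi, right_ne_zero_of_mul hi, by simp⟩, rfl⟩

/-- The coefficients of the adjoint, up to sign, are those of the products `∂_ν^k Q`.  This rests on
`(-1)^r (r - 1 - k choose r) = (k choose r)`. -/
lemma OrdLE.coeff_adjoint (hQ : OrdLE ν n Q) (k : ℤ) :
    (Int.negOnePow (1 + k) : ℤ) • (adjoint Q).coeff (Pi.single ν (-1 - k)) =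
      (leftD (Pi.single ν k) Q).coeff (Pi.single ν (-1)) := by
  have hfin := finite_leftD (Pi.single ν k) (Pi.single ν (-1)) Q
  rw [coeff_leftD, adjoint]
  have hterm : ∀ r : Fin 2 → ℕ,
      (Int.negOnePow (∑ μ, ((Pi.single ν (-1 - k) : Fin 2 → ℤ) μ + r μ)) : ℤ) •
      (∏ μ, Ring.choose ((Pi.single ν (-1 - k) : Fin 2 → ℤ) μ + r μ) (r μ)) •
      F.delPow r (Q.coeff (fun μ => (Pi.single ν (-1 - k) : Fin 2 → ℤ) μ + r μ)) =
      (Int.negOnePow (1 + k) : ℤ) • (∏ μ, Ring.choose ((Pi.single ν k : Fin 2 → ℤ) μ) (r μ)) •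
      F.delPow r (Q.coeff (fun μ => (Pi.single ν (-1) : Fin 2 → ℤ) μ -
        (Pi.single ν k : Fin 2 → ℤ) μ + r μ)) := by
    intro r
    have e : (fun μ => (Pi.single ν (-1) : Fin 2 → ℤ) μ -
        (Pi.single ν k : Fin 2 → ℤ) μ + r μ) =
        fun μ => (Pi.single ν (-1 - k) : Fin 2 → ℤ) μ + r μ := by
      rw [Pi.single_sub]; rfl
    rw [e]
    by_cases h : Q.coeff (fun μ => (Pi.single ν (-1 - k) : Fin 2 → ℤ) μ + r μ) = 0
    · rw [h, F.delPow_zero, smul_zero, smul_zero, smul_zero, smul_zero]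
    have h1 := (hQ _ h).1
    have h2 : ∀ μ, μ ≠ ν → r μ = 0 := fun μ hμ => by
      have := congrFun h1 μ
      simpa [Pi.single_eq_of_ne hμ] using this
    rw [smul_smul, smul_smul]
    congr 1
    have key : ∀ s : ℕ, (Int.negOnePow (-1 - k + s) : ℤ) * Ring.choose (-1 - k + s : ℤ) s =
        Int.negOnePow (1 + k) * Ring.choose k s := by
      intro s
      have h3 := Ring.choose_neg (-k) s
      rw [neg_neg] at h3
      have h4 : (-k + s - 1 : ℤ) = -1 - k + s := by ring
      rw [h3, h4, Units.smul_def, smul_eq_mul, ← mul_assoc]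
      congr 1
      rw [← Units.val_mul, ← Int.negOnePow_add]
      congr 1
      rw [Int.negOnePow_eq_iff]
      exact ⟨-1 - k, by ring⟩
    fin_cases ν
    · have h5 := h2 1 (by decide)
      simpa [Fin.prod_univ_two, Fin.sum_univ_two, h5] using key (r 0)
    · have h5 := h2 0 (by decide)
      simpa [Fin.prod_univ_two, Fin.sum_univ_two, h5] using key (r 1)
  simp only [hterm]
  rw [← smul_finsum' _ hfin, smul_smul, ← Units.val_mul, Int.units_mul_self, Units.val_one,
    one_smul]

/-- The residue of a product of two wave functions is the residue of the product of the
operators. -/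
lemma coeff_ampPos_mul_ampNeg_adjoint (hP : OrdLE ν m P) (hQ : OrdLE ν n Q) :
    (ampPos ν P * ampNeg ν (adjoint Q)).coeff 1 = (P * Q).coeff (Pi.single ν (-1)) := by
  rw [HahnSeries.coeff_mul_eq_finsum, coeff_mul]
  have hinj : Function.Injective fun i : ℤ => (Pi.single ν (-i) : Fin 2 → ℤ) :=
    (Pi.single_injective ν).comp neg_injective
  rw [← finsum_mem_univ (fun α => P.coeff α * _),
    finsum_mem_inter_support_eq' _ _ (Set.range fun i : ℤ => (Pi.single ν (-i) : Fin 2 → ℤ)),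
    finsum_mem_range hinj]
  · refine finsum_congr fun i => ?_
    have e : (-1 - -i : ℤ) = -(1 - i) := by ring
    rw [← hQ.coeff_adjoint, coeff_ampPos, coeff_ampNeg, e, ← sub_eq_add_neg]
  · intro α hα
    have := (hP α (left_ne_zero_of_mul hα)).1
    exact ⟨fun _ => ⟨-α ν, by simp [← this]⟩, fun _ => trivial⟩

lemma OrdLE.coeff_ampNeg_adjoint (hQ : OrdLE ν n Q) (j : ℤ) :
    (ampNeg ν (adjoint Q)).coeff j = (dpow F ν (j - 1) * Q).coeff (Pi.single ν (-1)) := by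
  rw [dpow, monomial_one_mul, ← hQ.coeff_adjoint, coeff_ampNeg]
  congr 3 <;> ring

end PDO

end

section

variable {A : Type*} [CommRing A] [Algebra ℂ A]

/-! ### Time derivatives of wave functions -/

/-- The amplitude of `∂w/∂t_i` for the function `w = L e^{ξ(t_ν; z)}`: it is `∂L/∂t_i + z^k L` if
`i = (ν, k)`, and `∂L/∂t_i` if `t_i` is a time of the other component. -/
def timeOp (F : TimeDerivations A) (ν : Fin 2) (i : Time) :
    LaurentSeries A →+ LaurentSeries A where
  toFun L := HahnSeries.map L (F.D i) +
    if i.1 = ν then HahnSeries.single (-(i.2 : ℤ)) 1 * L else 0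
  map_zero' := by ext; simp
  map_add' L L' := by
    split_ifs
    · ext; simp [mul_add]; ring
    · ext; simp

variable (F : TimeDerivations A)

lemma coeff_timeOp (ν : Fin 2) (i : Time) (L : LaurentSeries A) (n : ℤ) :
    (timeOp F ν i L).coeff n =
      F.D i (L.coeff n) + if i.1 = ν then L.coeff (n + i.2) else 0 := by
  simp only [timeOp, AddMonoidHom.coe_mk, ZeroHom.coe_mk]
  split_ifs
  · simp [HahnSeries.coeff_single_mul]
  · simp

lemma timeOp_smul (ν : Fin 2) (i : Time) (a : A) (L : LaurentSeries A) :
    timeOp F ν i (a • L) = F.D i a • L + a • timeOp F ν i L := by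
  ext n
  simp only [coeff_timeOp, HahnSeries.coeff_smul, HahnSeries.coeff_add, smul_eq_mul,
    Derivation.leibniz]
  split_ifs <;> ring

lemma timeOp_comm (ν : Fin 2) (i j : Time) (L : LaurentSeries A) :
    timeOp F ν i (timeOp F ν j L) = timeOp F ν j (timeOp F ν i L) := by
  ext n
  simp only [coeff_timeOp, F.comm i j, map_add]
  split_ifs <;> simp only [map_zero, add_right_comm n] <;> ring

/-- The time derivative `∂/∂t_i` of a pair of wave functions, in terms of the amplitudes. -/
def timeAct (i : Time) : (Fin 2 → LaurentSeries A) →+ (Fin 2 → LaurentSeries A) where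
  toFun v ν := timeOp F ν i (v ν)
  map_zero' := by ext1; simp
  map_add' _ _ := by ext1; simp

lemma timeAct_apply (i : Time) (v : Fin 2 → LaurentSeries A) (ν : Fin 2) :
    timeAct F i v ν = timeOp F ν i (v ν) := rfl

lemma timeAct_smul (i : Time) (a : A) (v : Fin 2 → LaurentSeries A) :
    timeAct F i (a • v) = F.D i a • v + a • timeAct F i v := by
  ext1 ν
  exact timeOp_smul F ν i a (v ν)

lemma timeAct_comm (i j : Time) (v : Fin 2 → LaurentSeries A) :
    timeAct F i (timeAct F j v) = timeAct F j (timeAct F i v) := by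
  ext1 ν
  exact timeOp_comm F ν i j (v ν)

lemma timeAct_iterate_apply (i : Time) (p : ℕ) (v : Fin 2 → LaurentSeries A) (ν : Fin 2) :
    (timeAct F i)^[p] v ν = (timeOp F ν i)^[p] (v ν) := by
  induction p with
  | zero => rfl
  | succ p ih => rw [Function.iterate_succ_apply', Function.iterate_succ_apply', timeAct_apply, ih]

variable {F}

/-- A span is stable under a time derivative as soon as the derivatives of its generators lie in
it. -/
lemma timeAct_mem_of_mem_span {S : Set (Fin 2 → LaurentSeries A)}
    {N : Submodule A (Fin 2 → LaurentSeries A)} (hS : Submodule.span A S ≤ N) {i : Time}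
    (h : ∀ v ∈ S, timeAct F i v ∈ N) {v : Fin 2 → LaurentSeries A}
    (hv : v ∈ Submodule.span A S) : timeAct F i v ∈ N := by
  induction hv using Submodule.span_induction with
  | mem v hv => exact h v hv
  | zero => rw [map_zero]; exact N.zero_mem
  | add u v _ _ hu hv => rw [map_add]; exact N.add_mem hu hv
  | smul a v hv ih =>
    rw [timeAct_smul]
    exact N.add_mem (N.smul_mem _ (hS hv)) (N.smul_mem _ ih)

variable (F)

/-! ### Taylor coefficients of the bilinear equation -/

lemma timePow_add_single (m : Time →₀ ℕ) (i : Time) :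
    F.timePow (m + Finsupp.single i 1) = (F.D i : Module.End ℂ A) * F.timePow m := by
  classical
  have hcomm : ∀ (m : Time →₀ ℕ) (s : Finset Time), (s : Set Time).Pairwise
      (Function.onFun Commute fun i => (F.D i : Module.End ℂ A) ^ m i) := fun m s i _ j _ _ => by
    have h : Commute (F.D i : Module.End ℂ A) (F.D j : Module.End ℂ A) :=
      LinearMap.ext fun f => F.comm i j f
    exact h.pow_pow _ _
  have key : ∀ m : Time →₀ ℕ, F.timePow m = (F.D i : Module.End ℂ A) ^ m i *
      (m.support.erase i).noncommProd (fun i => (F.D i : Module.End ℂ A) ^ m i)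
        (hcomm m _) := fun m => by
    by_cases hi : i ∈ m.support
    · exact (Finset.mul_noncommProd_erase _ hi _ _ _).symm
    · have h0 : m i = 0 := Finsupp.notMem_support_iff.1 hi
      rw [h0, pow_zero, one_mul]
      exact Finset.noncommProd_congr (Finset.erase_eq_of_notMem hi).symm (fun _ _ => rfl) _
  rw [key, key m, Finsupp.add_apply, Finsupp.single_eq_same, pow_succ', mul_assoc]
  congr 2
  refine Finset.noncommProd_congr ?_ (fun j hj => ?_) _
  · ext j
    by_cases e : j = i
    · simp [e]
    · simp [e]
  · rw [Finsupp.add_apply, Finsupp.single_eq_of_ne (Finset.ne_of_mem_erase hj), add_zero]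

lemma prod_factorial_add_single (m : Time →₀ ℕ) (i : Time) :
    (m + Finsupp.single i 1).prod (fun _ n => (n.factorial : ℂ)) =
      (m i + 1 : ℂ) * m.prod fun _ n => (n.factorial : ℂ) := by
  rw [← Finsupp.mul_prod_erase' _ i _ fun _ => by simp,
    ← Finsupp.mul_prod_erase' m i _ fun _ => by simp]
  have : (m + Finsupp.single i 1).erase i = m.erase i := by
    rw [Finsupp.erase_add, Finsupp.erase_single, add_zero]
  rw [this, Finsupp.add_apply, Finsupp.single_eq_same, Nat.factorial_succ]
  push_cast
  ring

lemma natCast_add_one_eq_C (k : ℕ) :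
    ((k : LaurentSeries A) + 1) = HahnSeries.C (algebraMap ℂ A (k + 1)) := by
  rw [map_add, map_natCast, map_one, map_add, map_natCast, map_one]

lemma coeff_pderiv_shift (L : LaurentSeries A) (i : Time) (m : Time →₀ ℕ) :
    MvPowerSeries.coeff m (MvPowerSeries.pderiv (LaurentSeries A) i (shift F L)) =
      HahnSeries.map (MvPowerSeries.coeff m (shift F L)) (F.D i) := by
  rw [MvPowerSeries.coeff_pderiv]
  change shift F L (m + Finsupp.single i 1) * ((m i : LaurentSeries A) + 1) =
    HahnSeries.map (shift F L m) (F.D i)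
  rw [natCast_add_one_eq_C]
  ext n
  have hm : (m i + 1 : ℂ) ≠ 0 := Nat.cast_add_one_ne_zero _
  rw [mul_comm, HahnSeries.C_mul_eq_smul]
  simp only [shift, HahnSeries.coeff_smul, HahnSeries.map_coeff, timePow_add_single,
    prod_factorial_add_single, LinearMap.smul_apply, Module.End.mul_apply, smul_eq_mul,
    ← Algebra.smul_def]
  rw [smul_smul, mul_inv, ← mul_assoc, mul_inv_cancel₀ hm, one_mul]
  exact ((F.D i).map_smul _ _).symm

lemma pderiv_expXi (ν : Fin 2) (i : Time) :
    MvPowerSeries.pderiv (LaurentSeries A) i (expXi A ν) =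
      MvPowerSeries.C (if i.1 = ν then HahnSeries.single (-(i.2 : ℤ)) 1 else 0) * expXi A ν := by
  refine MvPowerSeries.ext fun m => ?_
  rw [MvPowerSeries.coeff_pderiv, MvPowerSeries.coeff_C_mul]
  change expXi A ν (m + Finsupp.single i 1) * ((m i : LaurentSeries A) + 1) = _ * expXi A ν m
  have hsupp : (∀ j ∈ (m + Finsupp.single i 1).support, j.1 = ν) ↔
      i.1 = ν ∧ ∀ j ∈ m.support, j.1 = ν := by
    constructor
    · intro h
      refine ⟨h i (by simp), fun j hj => h j ?_⟩
      simp only [Finsupp.mem_support_iff, Finsupp.add_apply] at hj ⊢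
      omega
    · rintro ⟨h1, h2⟩ j hj
      by_cases e : i = j
      · exact e ▸ h1
      · refine h2 j ?_
        simpa [Finsupp.single_apply, e] using hj
  have hm : (m i + 1 : ℂ) ≠ 0 := Nat.cast_add_one_ne_zero _
  simp only [expXi, hsupp]
  by_cases h1 : i.1 = ν
  · by_cases h2 : ∀ j ∈ m.support, j.1 = ν
    · rw [if_pos ⟨h1, h2⟩, if_pos h1, if_pos h2, natCast_add_one_eq_C, HahnSeries.C_apply,
        HahnSeries.single_mul_single,
        HahnSeries.single_mul_single, prod_factorial_add_single, one_mul, ← map_mul, mul_inv,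
        mul_right_comm, inv_mul_cancel₀ hm, one_mul, Finsupp.sum_add_index', Finsupp.sum_single_index]
      · congr 1
        push_cast
        ring_nf
      · simp
      · simp
      · intros; push_cast; ring
    · rw [if_neg (fun h => h2 h.2), if_neg h2, zero_mul, mul_zero]
  · rw [if_neg (fun h => h1 h.1), if_neg h1, zero_mul, zero_mul]

/-- The coefficient of `s^m` in `L(t' + s; z) e^{ξ(s_ν; z)}`, that is, `1/m!` times the amplitude of
`∂^m (L e^{ξ(t_ν; z)})`. -/
def taylorCoeff (ν : Fin 2) (L : LaurentSeries A) (m : Time →₀ ℕ) : LaurentSeries A :=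
  MvPowerSeries.coeff m (shift F L * expXi A ν)

lemma taylorCoeff_zero (ν : Fin 2) (L : LaurentSeries A) : taylorCoeff F ν L 0 = L := by
  rw [taylorCoeff, MvPowerSeries.coeff_zero_eq_constantCoeff_apply, map_mul]
  have h1 : MvPowerSeries.constantCoeff (shift F L) = L := by
    change shift F L 0 = L
    ext n
    simp [shift, TimeDerivations.timePow]
  have h2 : MvPowerSeries.constantCoeff (expXi A ν) = 1 := by
    change expXi A ν 0 = 1
    simp [expXi]
  rw [h1, h2, mul_one]

lemma taylorCoeff_add_single (ν : Fin 2) (L : LaurentSeries A) (m : Time →₀ ℕ) (i : Time) :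
    taylorCoeff F ν L (m + Finsupp.single i 1) * ((m i : LaurentSeries A) + 1) =
      timeOp F ν i (taylorCoeff F ν L m) := by
  have h := MvPowerSeries.coeff_pderiv (R := LaurentSeries A) (i := i) (shift F L * expXi A ν) m
  rw [taylorCoeff, ← h, Derivation.leibniz, pderiv_expXi, smul_eq_mul, smul_eq_mul,
    mul_left_comm, map_add, MvPowerSeries.coeff_C_mul, add_comm]
  simp only [timeOp, AddMonoidHom.coe_mk, ZeroHom.coe_mk]
  congr 1
  · rw [mul_comm, taylorCoeff, MvPowerSeries.coeff_mul, MvPowerSeries.coeff_mul]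
    ext n
    simp only [coeff_pderiv_shift, HahnSeries.map_coeff, HahnSeries.coeff_sum, map_sum]
    refine Finset.sum_congr rfl fun p _ => ?_
    change (HahnSeries.map (shift F L p.1) (F.D i) * expXi A ν p.2).coeff n =
      F.D i ((shift F L p.1 * expXi A ν p.2).coeff n)
    unfold expXi
    split_ifs
    · rw [HahnSeries.coeff_mul_single, HahnSeries.coeff_mul_single, Derivation.leibniz,
        Derivation.map_algebraMap, smul_zero, zero_add, smul_eq_mul, mul_comm]
      rfl
    · simp
  · rw [taylorCoeff]
    split_ifs <;> simp

/-- The Taylor coefficients of a pair of wave functions. -/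
def taylorPair (w : Fin 2 → LaurentSeries A) (m : Time →₀ ℕ) : Fin 2 → LaurentSeries A :=
  fun ν => taylorCoeff F ν (w ν) m

lemma timeAct_taylorPair (w : Fin 2 → LaurentSeries A) (m : Time →₀ ℕ) (i : Time) :
    timeAct F i (taylorPair F w m) =
      algebraMap ℂ A (m i + 1) • taylorPair F w (m + Finsupp.single i 1) := by
  ext1 ν
  rw [timeAct_apply, taylorPair, ← taylorCoeff_add_single, mul_comm]
  rw [natCast_add_one_eq_C, HahnSeries.C_mul_eq_smul]
  rfl

/-- The difference of the two sides of the bilinear equation at `t = t'`, as an `A`-linear function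
of the pair `(w₁, w₂)`; the pair `(w₁^*, w₂^*)` is fixed. -/
def pairing (Ls : Fin 2 → LaurentSeries A) : (Fin 2 → LaurentSeries A) →ₗ[A] A where
  toFun v := (v 0 * Ls 0).coeff 1 - (v 1 * Ls 1).coeff (-1)
  map_add' u v := by simp [add_mul]; ring
  map_smul' a v := by
    have h : ∀ (x y : LaurentSeries A) n, ((a • x) * y).coeff n = a * (x * y).coeff n := by
      intro x y n
      rw [← HahnSeries.C_mul_eq_smul, mul_assoc, HahnSeries.C_mul_eq_smul]
      rfl
    simp only [Pi.smul_apply, h, smul_eq_mul, RingHom.id_apply]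
    ring

omit [Algebra ℂ A] in
lemma pairing_apply (Ls v : Fin 2 → LaurentSeries A) :
    pairing Ls v = (v 0 * Ls 0).coeff 1 - (v 1 * Ls 1).coeff (-1) := rfl

lemma bilinear_iff_taylorPair (w Ls : Fin 2 → LaurentSeries A) :
    Bilinear F (w 0) (Ls 0) (w 1) (Ls 1) ↔ ∀ m, pairing Ls (taylorPair F w m) = 0 := by
  refine funext_iff.trans (forall_congr' fun m => ?_)
  rw [pairing_apply, sub_eq_zero]
  have h : ∀ ν, MvPowerSeries.coeff m (twoTimes F ν (w ν) (Ls ν)) =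
      taylorPair F w m ν * Ls ν := fun ν => by
    rw [twoTimes, mul_right_comm, MvPowerSeries.coeff_mul_C]
    rfl
  simp only [resz, MvPowerSeries.coeff_C_mul, h, HahnSeries.coeff_single_mul, one_mul]
  norm_num

/-- The bilinear equation says that the pairing with `(w₁^*, w₂^*)` vanishes on the smallest
`A`-module that contains `(w₁, w₂)` and is stable under all time derivatives. -/
lemma bilinear_iff_exists_stable (w Ls : Fin 2 → LaurentSeries A) :
    Bilinear F (w 0) (Ls 0) (w 1) (Ls 1) ↔
      ∃ N : Submodule A (Fin 2 → LaurentSeries A), w ∈ N ∧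
        (∀ i, ∀ v ∈ N, timeAct F i v ∈ N) ∧ ∀ v ∈ N, pairing Ls v = 0 := by
  rw [bilinear_iff_taylorPair]
  have h0 : taylorPair F w 0 = w := funext fun ν => taylorCoeff_zero F ν (w ν)
  constructor
  · intro h
    refine ⟨Submodule.span A (Set.range (taylorPair F w)), ?_, fun i v hv => ?_, fun v hv => ?_⟩
    · exact Submodule.subset_span ⟨0, h0⟩
    · refine timeAct_mem_of_mem_span le_rfl ?_ hv
      rintro _ ⟨m, rfl⟩
      rw [timeAct_taylorPair]
      exact Submodule.smul_mem _ _ (Submodule.subset_span ⟨_, rfl⟩)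
    · have : Submodule.span A (Set.range (taylorPair F w)) ≤ LinearMap.ker (pairing Ls) :=
        Submodule.span_le.2 (by rintro _ ⟨m, rfl⟩; exact h m)
      exact this hv
  · rintro ⟨N, hw, hN, h⟩ m
    refine h _ ?_
    have step : ∀ m i, taylorPair F w m ∈ N → taylorPair F w (m + Finsupp.single i 1) ∈ N := by
      intro m i hm
      have h1 := N.smul_mem (algebraMap ℂ A (m i + 1 : ℂ)⁻¹) (hN i _ hm)
      rwa [timeAct_taylorPair, smul_smul, ← map_mul,
        inv_mul_cancel₀ (Nat.cast_add_one_ne_zero _), map_one, one_smul] at h1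
    induction m using Finsupp.induction with
    | zero => rwa [h0]
    | single_add i k m _ _ ih =>
      rw [add_comm]
      clear * - ih step
      induction k with
      | zero => simpa using ih
      | succ k ihk => rw [Finsupp.single_add, ← add_assoc]; exact step _ _ ihk

end

section

variable {A : Type*} [CommRing A] [Algebra ℂ A]

/-! ### Leading coefficients -/

/-- The series `L` contains no power `z^i` with `i > -a`. -/
def VanishBelow (a : ℤ) (L : LaurentSeries A) : Prop := ∀ j < a, L.coeff j = 0

section
omit [Algebra ℂ A]

lemma VanishBelow.mono {a b : ℤ} {L : LaurentSeries A} (h : VanishBelow a L) (hab : b ≤ a) :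
    VanishBelow b L := fun j hj => h j (hj.trans_le hab)

lemma VanishBelow.sub {a : ℤ} {L L' : LaurentSeries A} (h : VanishBelow a L)
    (h' : VanishBelow a L') : VanishBelow a (L - L') := fun j hj => by
  rw [HahnSeries.coeff_sub, h j hj, h' j hj, sub_zero]

lemma VanishBelow.succ {a : ℤ} {L : LaurentSeries A} (h : VanishBelow a L) (h0 : L.coeff a = 0) :
    VanishBelow (a + 1) L := fun j hj => by
  obtain h' | rfl := (Int.lt_add_one_iff.1 hj).lt_or_eq
  · exact h j h'
  · exact h0

lemma VanishBelow.mul {a b : ℤ} {L L' : LaurentSeries A} (h : VanishBelow a L)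
    (h' : VanishBelow b L') : VanishBelow (a + b) (L * L') := fun j hj => by
  rw [HahnSeries.coeff_mul_eq_finsum]
  refine finsum_eq_zero_of_forall_eq_zero fun i => ?_
  by_cases hi : i < a
  · rw [h i hi, zero_mul]
  · rw [h' (j - i) (by omega), mul_zero]

lemma VanishBelow.coeff_mul {a b : ℤ} {L L' : LaurentSeries A} (h : VanishBelow a L)
    (h' : VanishBelow b L') : (L * L').coeff (a + b) = L.coeff a * L'.coeff b := by
  rw [HahnSeries.coeff_mul_eq_finsum, finsum_eq_single _ a, add_sub_cancel_left]
  intro i hi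
  obtain hi | hi := hi.lt_or_gt
  · rw [h i hi, zero_mul]
  · rw [h' (a + b - i) (by omega), mul_zero]

lemma eq_zero_of_vanishBelow {L : LaurentSeries A} {a : ℤ} (h0 : VanishBelow a L)
    (h : ∀ n : ℕ, VanishBelow (a + n) L → L.coeff (a + n) = 0) : L = 0 := by
  have key : ∀ n : ℕ, VanishBelow (a + n) L := by
    intro n
    induction n with
    | zero => simpa using h0
    | succ n ih => push_cast; rw [← add_assoc]; exact ih.succ (h n ih)
  ext j
  exact key (j - a + 1).toNat j (by omega)

end

variable (F : TimeDerivations A)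

lemma VanishBelow.timeOp_iterate {a : ℤ} {L : LaurentSeries A} (h : VanishBelow a L)
    (ν : Fin 2) (p : ℕ) : VanishBelow (a - p) ((timeOp F ν (ν, 1))^[p] L) ∧
      ((timeOp F ν (ν, 1))^[p] L).coeff (a - p) = L.coeff a := by
  induction p with
  | zero => simpa using h
  | succ p ih =>
    obtain ⟨h1, h2⟩ := ih
    rw [Function.iterate_succ_apply']
    constructor
    · intro j hj
      push_cast at hj
      rw [coeff_timeOp, h1 j (by omega), map_zero, zero_add, if_pos rfl]
      exact h1 _ (by push_cast; omega)
    · push_cast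
      rw [coeff_timeOp, h1 _ (by omega), map_zero, zero_add, if_pos rfl, ← h2]
      congr 1
      push_cast
      ring

variable {F}

lemma coeff_timeOp_iterate_of_ne {ν μ : Fin 2} (hμ : ν ≠ μ) (k : ℕ+) (p : ℕ)
    (L : LaurentSeries A) (n : ℤ) :
    ((timeOp F μ (ν, k))^[p] L).coeff n = (F.D (ν, k))^[p] (L.coeff n) := by
  induction p with
  | zero => rfl
  | succ p ih =>
    rw [Function.iterate_succ_apply', Function.iterate_succ_apply', coeff_timeOp, if_neg hμ,
      add_zero, ih]

lemma iterate_D_zero (i : Time) (p : ℕ) : (F.D i)^[p] 0 = 0 :=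
  Function.iterate_fixed (map_zero (F.D i)) p

lemma VanishBelow.timeOp_iterate_of_ne {a : ℤ} {L : LaurentSeries A} (h : VanishBelow a L)
    {ν μ : Fin 2} (hμ : ν ≠ μ) (k : ℕ+) (p : ℕ) : VanishBelow a ((timeOp F μ (ν, k))^[p] L) :=
  fun j hj => by rw [coeff_timeOp_iterate_of_ne hμ, h j hj, iterate_D_zero]

/-- A pair of functions of low order in a stable module on which the
pairing vanishes is zero, because the derivatives with respect to `x` and `y` bring the leading
coefficients of its components into the residue. -/
lemma eq_zero_of_mem_stable {N : Submodule A (Fin 2 → LaurentSeries A)}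
    {Ls : Fin 2 → LaurentSeries A} (hN : ∀ i, ∀ v ∈ N, timeAct F i v ∈ N)
    (hpair : ∀ v ∈ N, pairing Ls v = 0) (h0 : VanishBelow 0 (Ls 0)) (h1 : VanishBelow 0 (Ls 1))
    (hc0 : (Ls 0).coeff 0 = 1) (hc1 : (Ls 1).coeff 0 ∈ nonZeroDivisors A)
    {v : Fin 2 → LaurentSeries A} (hv : v ∈ N) (hv0 : VanishBelow 1 (v 0))
    (hv1 : VanishBelow 0 (v 1)) : v = 0 := by
  have hiter : ∀ i p, (timeAct F i)^[p] v ∈ N := by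
    intro i p
    induction p with
    | zero => exact hv
    | succ p ih => rw [Function.iterate_succ_apply']; exact hN i _ ih
  have e0 : v 0 = 0 := by
    refine eq_zero_of_vanishBelow hv0 fun n hn => ?_
    have hp := hpair _ (hiter (0, 1) n)
    rw [pairing_apply, timeAct_iterate_apply, timeAct_iterate_apply] at hp
    obtain ⟨h2, h3⟩ := hn.timeOp_iterate F 0 n
    have h4 := h2.coeff_mul h0
    rw [h3, hc0, mul_one, add_zero, add_sub_cancel_right] at h4
    rw [h4, ((hv1.timeOp_iterate_of_ne (by decide) 1 n).mul h1) (-1) (by norm_num), sub_zero] at hp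
    exact hp
  have e1 : v 1 = 0 := by
    refine eq_zero_of_vanishBelow hv1 fun n hn => ?_
    have hp := hpair _ (hiter (1, 1) (n + 1))
    rw [pairing_apply, timeAct_iterate_apply, timeAct_iterate_apply] at hp
    obtain ⟨h2, h3⟩ := hn.timeOp_iterate F 1 (n + 1)
    have h4 := h2.coeff_mul h1
    have e : (0 + n - ((n + 1 : ℕ) : ℤ) + 0) = -1 := by push_cast; ring
    rw [h3, e] at h4
    rw [e0, ← AddMonoidHom.coe_coe, iterate_map_zero, zero_mul, HahnSeries.coeff_zero, zero_sub,
      neg_eq_zero, h4] at hp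
    exact (mem_nonZeroDivisors_iff_right.1 hc1) _ hp
  ext1 ν
  fin_cases ν
  · exact e0
  · exact e1

/-- If the leading coefficient of `w` is invertible, the coefficients of the products
`(∂_ν^p w) L` at one power of `z` determine the remaining terms of `L`: as `p` grows, the leading
coefficient of `∂_ν^p w` meets one coefficient of `L` after the other. -/
lemma eq_of_coeff_timeOp_mul_eq {ν : Fin 2} {w L L' : LaurentSeries A} {u : Aˣ} (c : ℤ) (a p₀ : ℕ)
    (hc : a - p₀ = c) (hw : VanishBelow 0 w) (hu : w.coeff 0 = u)
    (hL : VanishBelow a (L - L'))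
    (h : ∀ p : ℕ, ((timeOp F ν (ν, 1))^[p + p₀] w * L).coeff c =
      ((timeOp F ν (ν, 1))^[p + p₀] w * L').coeff c) : L = L' := by
  rw [← sub_eq_zero]
  refine eq_zero_of_vanishBelow hL fun n hn => ?_
  obtain ⟨h2, h3⟩ := hw.timeOp_iterate F ν (n + p₀)
  have h4 := h2.coeff_mul hn
  have e : 0 - ((n + p₀ : ℕ) : ℤ) + (a + n) = c := by push_cast; rw [← hc]; ring
  rw [h3, e, mul_sub, HahnSeries.coeff_sub, h n, sub_self, hu] at h4
  exact (Units.mul_right_eq_zero u).1 h4.symm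

end

section

variable {A : Type*} [CommRing A] [Algebra ℂ A] {F : TimeDerivations A}
open PDO

/-! ### The flows in terms of wave functions -/

lemma vanishBelow_ampPos {ν : Fin 2} {n : ℤ} {P : PDO F} (h : OrdLE ν n P) :
    VanishBelow (-n) (ampPos ν P) := fun _ hj => h.coeff_eq_zero (by omega)

lemma timeOp_ampPos (ν : Fin 2) (k : ℕ+) (P : PDO F) :
    timeOp F ν (ν, k) (ampPos ν P) = ampPos ν (dt (ν, k) P + P * dpow F ν k) := by
  ext n
  rw [coeff_timeOp, if_pos rfl, ampPos_add, HahnSeries.coeff_add, coeff_ampPos, coeff_ampPos,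
    coeff_ampPos, coeff_ampPos, coeff_mul_dpow, ← Pi.single_sub]
  congr 3
  push_cast
  ring_nf

lemma timeOp_ampPos_of_ne {ν μ : Fin 2} (h : ν ≠ μ) (k : ℕ+) (P : PDO F) :
    timeOp F μ (ν, k) (ampPos μ P) = ampPos μ (dt (ν, k) P) := by
  ext n
  rw [coeff_timeOp, if_neg h, add_zero]
  rfl

lemma timeOp_one_ampPos (ν : Fin 2) (P : PDO F) :
    timeOp F ν (ν, 1) (ampPos ν P) = ampPos ν (dpow F ν 1 * P) := by
  rw [timeOp_ampPos, dpow_one_mul, add_comm]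
  rfl

lemma timeOp_iterate_ampPos (ν : Fin 2) (p : ℕ) (P : PDO F) :
    (timeOp F ν (ν, 1))^[p] (ampPos ν P) = ampPos ν (dpow F ν p * P) := by
  induction p with
  | zero => rw [Nat.cast_zero, dpow_zero, one_mul]; rfl
  | succ p ih =>
    rw [Function.iterate_succ_apply', ih, timeOp_one_ampPos, ← mul_assoc, dpow_mul_dpow]
    push_cast
    rw [add_comm]

lemma ampPos_fn_mul (ν : Fin 2) (f : A) (P : PDO F) :
    ampPos ν (fn F f * P) = f • ampPos ν P := by
  ext n
  rw [coeff_ampPos, coeff_fn_mul]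
  rfl

lemma ampPos_sum {ι : Type*} (ν : Fin 2) (s : Finset ι) (P : ι → PDO F) :
    ampPos ν (∑ i ∈ s, P i) = ∑ i ∈ s, ampPos ν (P i) := by
  ext n
  rw [coeff_ampPos, coeff_sum, HahnSeries.coeff_sum]
  rfl

/-- A differential operator in one derivation is a finite sum. -/
lemma PDO.OrdLE.eq_sum {ν : Fin 2} {k : ℕ} {B : PDO F} (hB : OrdLE ν k B)
    (hB0 : ∀ j < 0, B.coeff (Pi.single ν j) = 0) :
    B = ∑ j ∈ Finset.range (k + 1), fn F (B.coeff (Pi.single ν (j : ℤ))) * dpow F ν j := by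
  refine hB.ext_ampPos (OrdLE.sum (n := k) _ _ fun j hj => ?_) ?_
  · exact ((ordLE_fn ν _).mul (ordLE_dpow ν j)).mono (by simp at hj; omega)
  · ext n
    rw [coeff_ampPos, coeff_ampPos, coeff_sum]
    obtain ⟨t, rfl⟩ : ∃ t, n = -t := ⟨-n, by ring⟩
    rw [neg_neg]
    simp only [coeff_fn_mul, dpow, coeff_monomial]
    have hs : ∀ j : ℤ, (Pi.single (Pi.single ν j) 1 : (Fin 2 → ℤ) → A) (Pi.single ν t) =
        if t = j then 1 else 0 := fun j => by
      rw [Pi.single_apply]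
      simp only [(Pi.single_injective ν).eq_iff]
    simp only [hs]
    by_cases h : 0 ≤ t ∧ t ≤ k
    · obtain ⟨t, rfl⟩ := Int.eq_ofNat_of_zero_le h.1
      rw [Finset.sum_eq_single t]
      · simp
      · intro j _ hj
        rw [if_neg (by exact_mod_cast hj.symm), mul_zero]
      · intro ht
        simp at ht
        omega
    · rw [Finset.sum_eq_zero]
      · by_cases h0 : t < 0
        · exact hB0 t h0
        · exact hB.coeff_eq_zero (by omega)
      · intro j hj
        simp at hj
        rw [if_neg (by omega), mul_zero]

lemma ampPos_mul_eq_sum {ν : Fin 2} {k : ℕ} {B : PDO F} (hB : OrdLE ν k B)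
    (hB0 : ∀ j < 0, B.coeff (Pi.single ν j) = 0) (P : PDO F) :
    ampPos ν (B * P) = ∑ j ∈ Finset.range (k + 1),
      B.coeff (Pi.single ν (j : ℤ)) • (timeOp F ν (ν, 1))^[j] (ampPos ν P) := by
  conv_lhs => rw [hB.eq_sum hB0, Finset.sum_mul, ampPos_sum]
  refine Finset.sum_congr rfl fun j _ => ?_
  rw [mul_assoc, ampPos_fn_mul, timeOp_iterate_ampPos]

lemma delPow_single (ν : Fin 2) (j : ℕ) (f : A) :
    F.delPow (Pi.single ν j) f = (F.D (ν, 1))^[j] f := by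
  fin_cases ν <;> simp [TimeDerivations.delPow] <;> rfl

lemma ampPos_act_eq_sum {ν μ : Fin 2} (hμ : ν ≠ μ) {k : ℕ} {B : PDO F} (hB : OrdLE ν k B)
    (P : PDO F) :
    ampPos μ (act B P) = ∑ j ∈ Finset.range (k + 1),
      B.coeff (Pi.single ν (j : ℤ)) • (timeOp F μ (ν, 1))^[j] (ampPos μ P) := by
  ext n
  rw [coeff_ampPos, HahnSeries.coeff_sum]
  have hinj : Function.Injective fun j : ℕ => (Pi.single ν j : Fin 2 → ℕ) :=
    Pi.single_injective (M := fun _ => ℕ) ν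
  have hcast : ∀ j : ℕ, (fun μ => ((Pi.single ν j : Fin 2 → ℕ) μ : ℤ)) = Pi.single ν (j : ℤ) := by
    intro j
    funext μ
    by_cases e : μ = ν
    · subst e; simp
    · simp [Pi.single_eq_of_ne e]
  change (∑ᶠ r : Fin 2 → ℕ, B.coeff (fun μ => (r μ : ℤ)) *
    F.delPow r (P.coeff (Pi.single μ (-n)))) = _
  rw [← finsum_mem_univ, finsum_mem_inter_support_eq' _ _
    (Set.range fun j : ℕ => (Pi.single ν j : Fin 2 → ℕ)), finsum_mem_range hinj,
    finsum_eq_sum_of_support_subset (s := Finset.range (k + 1))]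
  · refine Finset.sum_congr rfl fun j _ => ?_
    rw [hcast, delPow_single, HahnSeries.coeff_smul, coeff_timeOp_iterate_of_ne hμ, coeff_ampPos,
      smul_eq_mul]
  · intro j hj
    have h := left_ne_zero_of_mul hj
    rw [hcast] at h
    have := (hB _ h).2
    simp at this ⊢
    omega
  · intro r hr
    have h := (hB _ (left_ne_zero_of_mul hr)).1
    refine ⟨fun _ => ⟨r ν, ?_⟩, fun _ => trivial⟩
    funext μ
    have h' := congrFun h μ
    by_cases e : μ = ν
    · subst e; simp
    · rw [Pi.single_eq_of_ne e] at h'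
      refine (Pi.single_eq_of_ne e _).trans ?_
      exact_mod_cast h'.symm

lemma PDO.OrdLE.act {ν : Fin 2} {n : ℤ} {P : PDO F} (h : OrdLE ν n P) (B : PDO F) :
    OrdLE ν n (act B P) := fun α hα => h α fun e => hα (by simp [PDO.act, e, F.delPow_zero])

lemma PDO.OrdLE.truncGE {ν : Fin 2} {m : ℤ} {P : PDO F} (h : OrdLE ν m P) (n : ℤ) :
    OrdLE ν m (truncGE ν n P) := fun α hα => h α fun e => hα (by simp [PDO.truncGE, e])

lemma PDO.OrdLE.truncLT {ν : Fin 2} {m : ℤ} {P : PDO F} (h : OrdLE ν m P) (n : ℤ) :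
    OrdLE ν (n - 1) (truncLT ν n P) := fun α hα => by
  simp only [PDO.truncLT] at hα
  split_ifs at hα with h'
  · exact ⟨(h α hα).1, by omega⟩
  · exact absurd rfl hα

lemma truncGE_add_truncLT (ν : Fin 2) (n : ℤ) (P : PDO F) :
    truncGE ν n P + truncLT ν n P = P := by
  ext α
  simp only [truncGE, truncLT, coeff_add]
  split_ifs <;> first | omega | simp

lemma coeff_truncGE_of_lt {ν : Fin 2} {n j : ℤ} (h : j < n) (P : PDO F) :
    (truncGE ν n P).coeff (Pi.single ν j) = 0 := by
  simp [truncGE, h]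

variable {ν μ : Fin 2} {P : PDO F}

lemma ordLE_lax_pow (h0 : OrdLE ν 0 P) (hi : OrdLE ν 0 P⁻¹) (h : P⁻¹ * P = 1) (h' : P * P⁻¹ = 1)
    (k : ℕ) : OrdLE ν k (lax ν P ^ k) := by
  rw [lax_pow h h']
  exact ((h0.mul (ordLE_dpow ν k)).mul hi).mono (by omega)

lemma dt_add_mul_dpow (h : P⁻¹ * P = 1) (h' : P * P⁻¹ = 1) (n : ℤ) (k : ℕ+) :
    dt (ν, k) P + P * dpow F ν k = (dt (ν, k) P + truncLT ν n (lax ν P ^ (k : ℕ)) * P) +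
      truncGE ν n (lax ν P ^ (k : ℕ)) * P := by
  have e : lax ν P ^ (k : ℕ) * P = P * dpow F ν k := by
    rw [lax_pow h h', mul_assoc, h, mul_one]
  rw [← e, add_assoc, ← add_mul, add_comm (truncLT _ _ _), truncGE_add_truncLT]

lemma timeOp_ampPos_sub (h0 : OrdLE ν 0 P) (hi : OrdLE ν 0 P⁻¹) (h : P⁻¹ * P = 1)
    (h' : P * P⁻¹ = 1) {n : ℤ} (hn : 0 ≤ n) (k : ℕ+) :
    timeOp F ν (ν, k) (ampPos ν P) - ∑ j ∈ Finset.range ((k : ℕ) + 1),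
        (truncGE ν n (lax ν P ^ (k : ℕ))).coeff (Pi.single ν (j : ℤ)) •
          (timeOp F ν (ν, 1))^[j] (ampPos ν P) =
      ampPos ν (dt (ν, k) P + truncLT ν n (lax ν P ^ (k : ℕ)) * P) := by
  rw [timeOp_ampPos, ← ampPos_mul_eq_sum ((ordLE_lax_pow h0 hi h h' k).truncGE n)
    fun j hj => coeff_truncGE_of_lt (by omega) _, dt_add_mul_dpow h h' n, ampPos_add,
    add_sub_cancel_right]

/-- The flow of `Φ_ν` along its own times says that the wave function satisfies the linear equation
`∂w/∂t_{ν,k} = (P_ν^k)_{≥ n} w`. -/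
lemma flow_same_iff (h0 : OrdLE ν 0 P) (hi : OrdLE ν 0 P⁻¹) (h : P⁻¹ * P = 1) (h' : P * P⁻¹ = 1)
    {n : ℤ} (hn : 0 ≤ n) (k : ℕ+) :
    dt (ν, k) P = -(truncLT ν n (lax ν P ^ (k : ℕ))) * P ↔
      timeOp F ν (ν, k) (ampPos ν P) = ∑ j ∈ Finset.range ((k : ℕ) + 1),
        (truncGE ν n (lax ν P ^ (k : ℕ))).coeff (Pi.single ν (j : ℤ)) •
          (timeOp F ν (ν, 1))^[j] (ampPos ν P) := by
  have hl := (ordLE_lax_pow h0 hi h h' k).truncLT n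
  rw [← sub_eq_zero (a := timeOp F ν (ν, k) _), timeOp_ampPos_sub h0 hi h h' hn, neg_mul,
    eq_neg_iff_add_eq_zero]
  have hd := ((h0.dt (ν, k)).mono hn).add ((hl.mul h0).mono (by omega : n - 1 + 0 ≤ n))
  exact ⟨fun e => by rw [e]; rfl, fun e => hd.ext_ampPos (OrdLE.zero (n := 0)) (e.trans rfl)⟩

lemma flow_other_iff (hμ : ν ≠ μ) {Q B : PDO F} {k : ℕ+} (hB : OrdLE ν k B) (hQ : OrdLE μ 0 Q) :
    dt (ν, k) Q = act B Q ↔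
      timeOp F μ (ν, k) (ampPos μ Q) = ∑ j ∈ Finset.range ((k : ℕ) + 1),
        B.coeff (Pi.single ν (j : ℤ)) • (timeOp F μ (ν, 1))^[j] (ampPos μ Q) := by
  rw [timeOp_ampPos_of_ne hμ, ← ampPos_act_eq_sum hμ hB]
  exact ⟨fun e => by rw [e], fun e => (hQ.dt _).ext_ampPos (hQ.act B) e⟩

/-! ### The constraint -/

lemma dt_fn (i : Time) (f : A) : dt i (fn F f) = fn F (F.D i f) := by
  ext α
  simp only [dt, fn, coeff_monomial]
  by_cases h : α = 0
  · subst h; simp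
  · simp [Pi.single_eq_of_ne h]

lemma D_units_inv (i : Time) (E : Aˣ) :
    (E : A) * F.D i ((E⁻¹ : Aˣ) : A) = -(F.D i E * ((E⁻¹ : Aˣ) : A)) := by
  have h := (F.D i).leibniz (E : A) ((E⁻¹ : Aˣ) : A)
  rw [Units.mul_inv, Derivation.map_one_eq_zero, smul_eq_mul, smul_eq_mul] at h
  rw [eq_neg_iff_add_eq_zero, mul_comm (F.D i E), ← h]

/-- The constraint `e^β ∂₁ e^{-β} Φ₁ ∂₂ Φ₁⁻¹ = ∂₂ Φ₂ ∂₁ Φ₂⁻¹` with the derivations moved to the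
left of the dressing operators. -/
lemma constraint_iff_sub_eq (E : Aˣ) {P Q : PDO F} (hP : P * P⁻¹ = 1) (hQ : Q * Q⁻¹ = 1) :
    fn F (E : A) * dpow F 0 1 * fn F ((E⁻¹ : Aˣ) : A) * P * dpow F 1 1 * P⁻¹ =
        dpow F 1 1 * Q * dpow F 0 1 * Q⁻¹ ↔
      (dpow F 0 1 - fn F (F.D (0, 1) E * ((E⁻¹ : Aˣ) : A))) * dt (1, 1) P * P⁻¹ =
        dpow F 1 1 * dt (0, 1) Q * Q⁻¹ -
          fn F (F.D (0, 1) E * ((E⁻¹ : Aˣ) : A)) * dpow F 1 1 := by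
  set d1 := dpow F 0 1
  set d2 := dpow F 1 1
  set b := fn F (F.D (0, 1) E * ((E⁻¹ : Aˣ) : A)) with hb
  set X := dt (1, 1) P with hX
  set Y := dt (0, 1) Q with hY
  have e1 : fn F (E : A) * d1 * fn F ((E⁻¹ : Aˣ) : A) = d1 - b := by
    rw [mul_assoc, dpow_one_mul, dt_fn, mul_add, ← mul_assoc, fn_mul_fn, fn_mul_fn, Units.mul_inv,
      fn_one, one_mul, D_units_inv, sub_eq_add_neg]
    congr 1
    ext α
    simp only [hb, fn, coeff_neg, coeff_monomial]
    by_cases h : α = 0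
    · subst h; simp
    · simp [Pi.single_eq_of_ne h]
  have e2 : P * d2 * P⁻¹ = d2 - X * P⁻¹ := by
    have : P * d2 = d2 * P - X := by rw [dpow_one_mul, hX]; abel
    rw [this, sub_mul, mul_assoc, hP, mul_one]
  have e3 : Q * d1 * Q⁻¹ = d1 - Y * Q⁻¹ := by
    have : Q * d1 = d1 * Q - Y := by rw [dpow_one_mul, hY]; abel
    rw [this, sub_mul, mul_assoc, hQ, mul_one]
  have l : fn F (E : A) * d1 * fn F ((E⁻¹ : Aˣ) : A) * P * d2 * P⁻¹ =
      d1 * d2 - b * d2 - (d1 - b) * X * P⁻¹ := by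
    rw [e1, mul_assoc (d1 - b), mul_assoc, e2]
    noncomm_ring
  have r : d2 * Q * d1 * Q⁻¹ = d1 * d2 - d2 * Y * Q⁻¹ := by
    rw [mul_assoc d2, mul_assoc, e3, mul_sub, dpow_comm 1 0, mul_assoc]
  rw [l, r]
  rw [sub_sub, sub_right_inj, eq_sub_iff_add_eq, add_comm]

/-- The constraint says that both wave functions satisfy
`∂₁ ∂₂ w = (∂₁ β) ∂₂ w + ρ w`: after the derivations are moved to the left, one side of the constraint
contains only powers of `∂₁` and the other one only powers of `∂₂`, so that both are functions. -/
lemma constraint_iff (E : Aˣ) {P Q : PDO F} (hP0 : OrdLE 0 0 P) (hP1 : P.coeff 0 = 1)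
    (hQ0 : OrdLE 1 0 Q) (hPi0 : OrdLE 0 0 P⁻¹) (hQi0 : OrdLE 1 0 Q⁻¹)
    (hP : P * P⁻¹ = 1) (hP' : P⁻¹ * P = 1) (hQ : Q * Q⁻¹ = 1) (hQ' : Q⁻¹ * Q = 1) :
    fn F (E : A) * dpow F 0 1 * fn F ((E⁻¹ : Aˣ) : A) * P * dpow F 1 1 * P⁻¹ =
        dpow F 1 1 * Q * dpow F 0 1 * Q⁻¹ ↔
      timeOp F 0 (0, 1) (timeOp F 0 (1, 1) (ampPos 0 P)) =
        (F.D (0, 1) E * ((E⁻¹ : Aˣ) : A)) • timeOp F 0 (1, 1) (ampPos 0 P) +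
          F.D (1, 1) (P.coeff (Pi.single 0 (-1))) • ampPos 0 P ∧
      timeOp F 1 (0, 1) (timeOp F 1 (1, 1) (ampPos 1 Q)) =
        (F.D (0, 1) E * ((E⁻¹ : Aˣ) : A)) • timeOp F 1 (1, 1) (ampPos 1 Q) +
          F.D (1, 1) (P.coeff (Pi.single 0 (-1))) • ampPos 1 Q := by
  rw [constraint_iff_sub_eq E hP hQ, timeOp_comm F 1, timeOp_one_ampPos 1,
    timeOp_ampPos_of_ne (ν := 1) (μ := 0) (by decide),
    timeOp_ampPos_of_ne (ν := 0) (μ := 1) (by decide), timeOp_one_ampPos,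
    timeOp_one_ampPos]
  set d1 := dpow F 0 1 with hd1
  set d2 := dpow F 1 1 with hd2
  set β := F.D (0, 1) E * ((E⁻¹ : Aˣ) : A)
  set ρ := F.D (1, 1) (P.coeff (Pi.single 0 (-1)))
  set X := dt (1, 1) P with hX
  set Y := dt (0, 1) Q with hY
  simp only [← ampPos_fn_mul, ← ampPos_add]
  have hX0 : OrdLE 0 (-1) X := fun α hα => by
    obtain ⟨h1, h2⟩ := hP0.dt (1, 1) α hα
    refine ⟨h1, ?_⟩
    by_contra h
    have h3 : α 0 = 0 := by omega
    rw [h3, Pi.single_zero] at h1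
    subst h1
    apply hα
    rw [hX]
    simp only [dt, hP1, Derivation.map_one_eq_zero]
  have hd1X : OrdLE 0 0 (d1 * X) := ((ordLE_dpow 0 1).mul hX0).mono (by omega)
  have hbX : OrdLE 0 0 (fn F β * X) := ((ordLE_fn 0 β).mul hX0).mono (by omega)
  have hZ : OrdLE 1 1 (d2 * Y) := ((ordLE_dpow 1 1).mul (hQ0.dt (0, 1))).mono (by omega)
  have iff1 : ampPos 0 (d1 * X) = ampPos 0 (fn F β * X + fn F ρ * P) ↔
      (d1 - fn F β) * X * P⁻¹ = fn F ρ := by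
    have h1 : ampPos 0 (d1 * X) = ampPos 0 (fn F β * X + fn F ρ * P) ↔
        d1 * X = fn F β * X + fn F ρ * P :=
      ⟨fun e => hd1X.ext_ampPos (hbX.add ((ordLE_fn 0 ρ).mul hP0)) e, fun e => by rw [e]⟩
    rw [h1]
    constructor
    · intro e
      rw [sub_mul, e, add_sub_cancel_left, mul_assoc, hP, mul_one]
    · intro e
      have := congrArg (· * P) e
      simp only [mul_assoc, hP', mul_one] at this
      rw [← this]
      noncomm_ring
  have iff2 : ampPos 1 (d2 * Y) = ampPos 1 (fn F β * (d2 * Q) + fn F ρ * Q) ↔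
      d2 * Y * Q⁻¹ - fn F β * d2 = fn F ρ := by
    have h1 : ampPos 1 (d2 * Y) = ampPos 1 (fn F β * (d2 * Q) + fn F ρ * Q) ↔
        d2 * Y = fn F β * (d2 * Q) + fn F ρ * Q :=
      ⟨fun e => hZ.ext_ampPos ((((ordLE_fn 1 β).mul ((ordLE_dpow 1 1).mul hQ0)).mono
        (by omega : (0 : ℤ) + (1 + 0) ≤ 1)).add (((ordLE_fn 1 ρ).mul hQ0).mono (by omega))) e,
        fun e => by rw [e]⟩
    rw [h1]
    constructor
    · intro e
      rw [e, add_mul, mul_assoc, mul_assoc, hQ, mul_assoc, hQ, mul_one, mul_one]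
      abel
    · intro e
      have := congrArg (· * Q) e
      simp only [mul_assoc, hQ', mul_one, sub_mul] at this
      rw [← this]
      abel
  rw [iff1, iff2]
  constructor
  · intro e
    have hU : OrdLE 0 0 ((d1 - fn F β) * X * P⁻¹) := by
      rw [sub_mul]
      exact ((hd1X.sub hbX).mul hPi0).mono (by omega)
    have hV : OrdLE 1 1 (d2 * Y * Q⁻¹ - fn F β * d2) :=
      ((hZ.mul hQi0).mono (by omega)).sub (((ordLE_fn 1 β).mul (ordLE_dpow 1 1)).mono (by omega))
    have hc : ((d1 - fn F β) * X * P⁻¹).coeff 0 = ρ := by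
      have h1 := hU.coeff_zero_mul hP0
      have h2 : (d1 - fn F β) * X * P⁻¹ * P = d1 * X - fn F β * X := by
        rw [mul_assoc, hP', mul_one, sub_mul]
      rw [hP1, mul_one, h2, coeff_sub] at h1
      rw [← h1, coeff_fn_mul, ← Pi.single_zero (0 : Fin 2), hX0.coeff_eq_zero (by omega), mul_zero,
        sub_zero]
      exact hX0.coeff_dpow_mul 1
    have hfn : (d1 - fn F β) * X * P⁻¹ = fn F ρ := by
      ext α
      by_cases h : α = 0
      · subst h
        rw [hc]
        simp [fn, coeff_monomial]
      · have hz : (fn F ρ).coeff α = 0 := Pi.single_eq_of_ne h _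
        rw [hz]
        by_contra hα
        have h1 := (hU α hα).1
        rw [e] at hα
        have h2 := (hV α hα).1
        apply h
        funext μ
        fin_cases μ
        · simpa using congrFun h2 0
        · simpa using congrFun h1 1
    exact ⟨hfn, e ▸ hfn⟩
  · rintro ⟨e1, e2⟩
    rw [e1, e2]

end

section

variable {A : Type*} [CommRing A] [Algebra ℂ A] (F : TimeDerivations A)
open PDO

/-! ### The Baker–Akhiezer functions -/

variable (E : Aˣ) (a₁ a₂ : ℕ → A)

lemma ordLE_Phi1 : OrdLE 0 0 (Phi1 F a₁) := ordLE_dressing 0 1 a₁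

lemma ordLE_Phi2 : OrdLE 1 0 (Phi2 F E a₂) := ordLE_dressing 1 _ a₂

lemma coeff_zero_Phi1 : (Phi1 F a₁).coeff 0 = 1 := by
  rw [← Pi.single_zero (0 : Fin 2), Phi1, coeff_dressing]
  simp

lemma Phi1_inv : OrdLE 0 0 (Phi1 F a₁)⁻¹ ∧ Phi1 F a₁ * (Phi1 F a₁)⁻¹ = 1 ∧
    (Phi1 F a₁)⁻¹ * Phi1 F a₁ = 1 :=
  (ordLE_Phi1 F a₁).exists_inverse 1 (coeff_zero_Phi1 F a₁)

lemma Phi2_inv : OrdLE 1 0 (Phi2 F E a₂)⁻¹ ∧ Phi2 F E a₂ * (Phi2 F E a₂)⁻¹ = 1 ∧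
    (Phi2 F E a₂)⁻¹ * Phi2 F E a₂ = 1 :=
  (ordLE_Phi2 F E a₂).exists_inverse E (by
    rw [← Pi.single_zero (1 : Fin 2), Phi2, coeff_dressing]
    simp)

lemma ordLE_Phi2bar : OrdLE 1 0 (Phi2bar F E a₁ a₂) :=
  (((((ordLE_dpow 1 2).mul (Phi2_inv F E a₂).1).mul (ordLE_dpow 1 (-1))).mul
    (ordLE_fn 1 _)).mul (ordLE_dpow 1 (-1))).mono (by norm_num)

lemma coeff_w1 (n : ℤ) :
    (w1 F a₁).coeff n = if n < 0 then 0 else if n = 0 then 1 else a₁ n.toNat := by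
  rw [w1, coeff_ampPos, Phi1, coeff_dressing]
  simp only [neg_neg, Left.neg_nonpos_iff, neg_eq_zero, one_mul]
  split_ifs <;> first | omega | rfl

lemma vanishBelow_w1 : VanishBelow 0 (w1 F a₁) := fun j hj => by rw [coeff_w1, if_pos hj]

lemma coeff_w2 (n : ℤ) :
    (w2 F E a₂).coeff n = if n < 0 then 0 else if n = 0 then (E : A) else E * a₂ n.toNat := by
  rw [w2, coeff_ampPos, Phi2, coeff_dressing]
  simp only [neg_neg, Left.neg_nonpos_iff, neg_eq_zero]
  split_ifs <;> first | omega | rfl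

lemma vanishBelow_w2 : VanishBelow 0 (w2 F E a₂) := fun j hj => by rw [coeff_w2, if_pos hj]

omit [Algebra ℂ A] in
lemma coeff_tailSeries (c : A) (b : ℕ → A) (n : ℤ) :
    (tailSeries c b).coeff n = if n < 0 then 0 else if n = 0 then c else b n.toNat := by
  rw [tailSeries]
  obtain h | ⟨k, rfl⟩ : n < 0 ∨ ∃ k : ℕ, n = k := by
    by_cases h : n < 0
    · exact Or.inl h
    · exact Or.inr ⟨n.toNat, by omega⟩
  · rw [if_pos h, HahnSeries.ofPowerSeries_apply, HahnSeries.embDomain_of_notMem_range]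
    rintro ⟨k, hk⟩
    have : (k : ℤ) = n := hk
    omega
  · rw [HahnSeries.ofPowerSeries_apply_coeff, PowerSeries.coeff_mk]
    simp

lemma w1_eq_tailSeries : w1 F a₁ = tailSeries 1 a₁ := by
  ext n
  rw [coeff_w1, coeff_tailSeries]

lemma w2_eq_tailSeries : w2 F E a₂ = HahnSeries.C (E : A) * tailSeries 1 a₂ := by
  ext n
  rw [HahnSeries.C_mul_eq_smul, HahnSeries.coeff_smul, coeff_w2, coeff_tailSeries]
  split_ifs <;> simp

/-- The pair of Baker–Akhiezer functions. -/
def waves : Fin 2 → LaurentSeries A := ![w1 F a₁, w2 F E a₂]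

lemma waves_zero : waves F E a₁ a₂ 0 = w1 F a₁ := rfl

lemma waves_one : waves F E a₁ a₂ 1 = w2 F E a₂ := rfl

/-- The operator `(P₁^k)_{≥ 0}` for `ν = 1` and `(P₂^k)_{≥ 1}` for `ν = 2`. -/
def flowOp (ν : Fin 2) (k : ℕ+) : PDO F :=
  ![truncGE 0 0 (lax 0 (Phi1 F a₁) ^ (k : ℕ)), truncGE 1 1 (lax 1 (Phi2 F E a₂) ^ (k : ℕ))] ν

lemma ordLE_flowOp (ν : Fin 2) (k : ℕ+) : OrdLE ν (k : ℕ) (flowOp F E a₁ a₂ ν k) := by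
  fin_cases ν
  · obtain ⟨h1, h2, h3⟩ := Phi1_inv F a₁
    exact (ordLE_lax_pow (ordLE_Phi1 F a₁) h1 h3 h2 k).truncGE 0
  · obtain ⟨h1, h2, h3⟩ := Phi2_inv F E a₂
    exact (ordLE_lax_pow (ordLE_Phi2 F E a₂) h1 h3 h2 k).truncGE 1

/-- The function `B w` for `B = (P_ν^k)_{≥ 0}` or `(P_ν^k)_{≥ 1}`. -/
def flowRhs (ν : Fin 2) (k : ℕ+) : Fin 2 → LaurentSeries A :=
  ∑ j ∈ Finset.range ((k : ℕ) + 1), (flowOp F E a₁ a₂ ν k).coeff (Pi.single ν (j : ℤ)) •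
    (timeAct F (ν, 1))^[j] (waves F E a₁ a₂)

lemma flowRhs_apply (ν μ : Fin 2) (k : ℕ+) :
    flowRhs F E a₁ a₂ ν k μ = ∑ j ∈ Finset.range ((k : ℕ) + 1),
      (flowOp F E a₁ a₂ ν k).coeff (Pi.single ν (j : ℤ)) •
        (timeOp F μ (ν, 1))^[j] (waves F E a₁ a₂ μ) := by
  rw [flowRhs, Finset.sum_apply]
  simp only [Pi.smul_apply, timeAct_iterate_apply]

/-- The hierarchy is the linear system
`∂w/∂t_{1,k} = (P₁^k)_{≥ 0} w`, `∂w/∂t_{2,k} = (P₂^k)_{≥ 1} w`, `∂₁ ∂₂ w = (∂₁ β) ∂₂ w + ρ w`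
for the pair `w` of Baker–Akhiezer functions. -/
lemma isSolution_iff : IsSolution F E a₁ a₂ ↔
    (∀ ν k, timeAct F (ν, k) (waves F E a₁ a₂) = flowRhs F E a₁ a₂ ν k) ∧
      timeAct F (0, 1) (timeAct F (1, 1) (waves F E a₁ a₂)) =
        (F.D (0, 1) E * ((E⁻¹ : Aˣ) : A)) • timeAct F (1, 1) (waves F E a₁ a₂) +
          rho F a₁ • waves F E a₁ a₂ := by
  obtain ⟨h1, h2, h3⟩ := Phi1_inv F a₁
  obtain ⟨h4, h5, h6⟩ := Phi2_inv F E a₂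
  have hP := ordLE_Phi1 F a₁
  have hQ := ordLE_Phi2 F E a₂
  have f11 := fun k => flow_same_iff hP h1 h3 h2 le_rfl k
  have f22 := fun k => flow_same_iff hQ h4 h6 h5 zero_le_one k
  have f12 := fun k => flow_other_iff (by decide) (ordLE_flowOp F E a₁ a₂ 0 k) hQ
  have f21 := fun k => flow_other_iff (by decide) (ordLE_flowOp F E a₁ a₂ 1 k) hP
  have hc := constraint_iff E hP (coeff_zero_Phi1 F a₁) hQ h1 h4 h2 h3 h5 h6
  have ha : (Phi1 F a₁).coeff (Pi.single 0 (-1)) = a₁ 1 := by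
    rw [Phi1, coeff_dressing]; simp
  rw [ha] at hc
  simp only [funext_iff, Fin.forall_fin_two, timeAct_apply, flowRhs_apply, waves_zero, waves_one,
    Pi.add_apply, Pi.smul_apply]
  constructor
  · intro h
    exact ⟨⟨fun k => ⟨(f11 k).1 (h.flow11 k), (f12 k).1 (h.flow12 k)⟩,
      fun k => ⟨(f21 k).1 (h.flow21 k), (f22 k).1 (h.flow22 k)⟩⟩, hc.1 h.constraint⟩
  · rintro ⟨⟨g0, g1⟩, g⟩
    exact ⟨fun k => (f11 k).2 (g0 k).1, fun k => (f22 k).2 (g1 k).2, fun k => (f21 k).2 (g1 k).1,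
      fun k => (f12 k).2 (g0 k).2, hc.2 g⟩

/-! ### Residues of the Baker–Akhiezer functions -/

lemma vanishBelow_ampNeg_adjoint {ν : Fin 2} {Q : PDO F} (hQ : OrdLE ν 0 Q) :
    VanishBelow 0 (ampNeg ν (adjoint Q)) := fun j hj => by
  rw [hQ.coeff_ampNeg_adjoint]
  exact ((ordLE_dpow ν (j - 1)).mul hQ).coeff_eq_zero (by omega)

lemma vanishBelow_w1star : VanishBelow 0 (w1star F a₁) :=
  vanishBelow_ampNeg_adjoint F (Phi1_inv F a₁).1

lemma vanishBelow_w2star : VanishBelow 0 (w2star F E a₁ a₂) :=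
  vanishBelow_ampNeg_adjoint F (ordLE_Phi2bar F E a₁ a₂)

lemma coeff_zero_w1star : (w1star F a₁).coeff 0 = 1 := by
  obtain ⟨h1, h2, -⟩ := Phi1_inv F a₁
  have h3 := (ordLE_Phi1 F a₁).coeff_zero_mul h1
  rw [h2, coeff_zero_Phi1, one_mul, coeff_one, Pi.single_eq_same] at h3
  have h4 := h1.coeff_dpow_mul (-1)
  rw [add_zero, Pi.single_zero, ← h3] at h4
  rw [w1star, h1.coeff_ampNeg_adjoint]
  exact h4

/-- `res_z (∂₁^p w₁) w₁^* = res ∂₁^p Φ₁ Φ₁⁻¹ = 0`. -/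
lemma residue_w1_w1star (p : ℕ) :
    ((timeOp F 0 (0, 1))^[p] (w1 F a₁) * w1star F a₁).coeff 1 = 0 := by
  obtain ⟨h1, h2, -⟩ := Phi1_inv F a₁
  rw [w1, timeOp_iterate_ampPos, w1star,
    coeff_ampPos_mul_ampNeg_adjoint ((ordLE_dpow 0 p).mul (ordLE_Phi1 F a₁)) h1, mul_assoc, h2,
    mul_one, dpow, coeff_monomial]
  exact Pi.single_eq_of_ne (fun e => by have := congrFun e 0; simp at this) _

lemma coeff_dpow_mul_fn (ν : Fin 2) (q : ℕ) (f : A) :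
    (dpow F ν q * fn F f).coeff 0 = (F.D (ν, 1))^[q] f ∧
      ∀ j < 0, (dpow F ν q * fn F f).coeff (Pi.single ν j) = 0 := by
  induction q with
  | zero =>
    rw [Nat.cast_zero, dpow_zero, one_mul]
    refine ⟨by simp [fn, coeff_monomial], fun j hj => ?_⟩
    rw [fn, coeff_monomial]
    exact Pi.single_eq_of_ne (fun e => by have := congrFun e ν; simp at this; omega) _
  | succ q ih =>
    have e : dpow F ν ((q + 1 : ℕ) : ℤ) = dpow F ν 1 * dpow F ν q := by
      rw [dpow_mul_dpow, Nat.cast_succ, add_comm]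
    rw [e, mul_assoc]
    refine ⟨?_, fun j hj => ?_⟩
    · rw [coeff_dpow_one_mul, ih.1, zero_sub, ← Pi.single_neg, ih.2 _ (by norm_num), add_zero,
        Function.iterate_succ_apply']
    · rw [coeff_dpow_one_mul, ih.2 j hj, map_zero, ← Pi.single_sub, ih.2 _ (by omega), add_zero]

/-- `res_z z⁻² (∂₂^{q+1} w₂) w₂^* = res ∂₂^{q+1} Φ₂ ∂₂⁻² Φ̄₂ = res ∂₂^q ρ ∂₂⁻¹ = ∂₂^q(ρ)`. -/
lemma residue_w2_w2star (q : ℕ) :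
    ((timeOp F 1 (1, 1))^[q + 1] (w2 F E a₂) * w2star F E a₁ a₂).coeff (-1) =
      (F.D (1, 1))^[q] (rho F a₁) := by
  obtain ⟨-, h2, -⟩ := Phi2_inv F E a₂
  set X := dpow F 1 ((q + 1 : ℕ) : ℤ) * Phi2 F E a₂ with hX
  have e1 : HahnSeries.single (2 : ℤ) (1 : A) * ampPos 1 X = ampPos 1 (X * dpow F 1 (-2)) := by
    ext n
    rw [HahnSeries.coeff_single_mul, one_mul, coeff_ampPos, coeff_ampPos, coeff_mul_dpow,
      ← Pi.single_sub]
    congr 2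
    ring
  have e2 : ∀ L : LaurentSeries A,
      L.coeff (-1) = (HahnSeries.single (2 : ℤ) (1 : A) * L).coeff 1 := fun L => by
    rw [HahnSeries.coeff_single_mul, one_mul]
    norm_num
  have e3 : X * dpow F 1 (-2) * Phi2bar F E a₁ a₂ =
      dpow F 1 q * fn F (rho F a₁) * dpow F 1 (-1) := by
    calc X * dpow F 1 (-2) * Phi2bar F E a₁ a₂
        = dpow F 1 ((q + 1 : ℕ) : ℤ) * (Phi2 F E a₂ * (dpow F 1 (-2) * dpow F 1 2) *
          (Phi2 F E a₂)⁻¹) * dpow F 1 (-1) * fn F (rho F a₁) * dpow F 1 (-1) := by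
          rw [hX, Phi2bar]; simp only [mul_assoc]
      _ = _ := by
          rw [dpow_mul_dpow, neg_add_cancel, dpow_zero, mul_one, h2, mul_one, dpow_mul_dpow]
          push_cast
          rw [add_neg_cancel_right]
  have hX0 : OrdLE 1 (((q + 1 : ℕ) : ℤ) + 0 + -2) (X * dpow F 1 (-2)) :=
    ((ordLE_dpow 1 _).mul (ordLE_Phi2 F E a₂)).mul (ordLE_dpow 1 _)
  rw [w2, timeOp_iterate_ampPos, e2, ← mul_assoc, e1, w2star,
    coeff_ampPos_mul_ampNeg_adjoint hX0 (ordLE_Phi2bar F E a₁ a₂), e3, coeff_mul_dpow, sub_self,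
    (coeff_dpow_mul_fn F 1 q _).1]

/-- `res_z (∂₂^{q+1} w₁) L = ∂₂^q(ρ)` for every `L` of the form `1 + O(z⁻¹)`. -/
lemma residue_w1_of_coeff_zero_eq_one {L : LaurentSeries A} (hL : VanishBelow 0 L)
    (hL0 : L.coeff 0 = 1) (q : ℕ) :
    ((timeOp F 0 (1, 1))^[q + 1] (w1 F a₁) * L).coeff 1 = (F.D (1, 1))^[q] (rho F a₁) := by
  have h : VanishBelow 1 ((timeOp F 0 (1, 1))^[q + 1] (w1 F a₁)) := by
    refine VanishBelow.succ (a := 0)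
      ((vanishBelow_w1 F a₁).timeOp_iterate_of_ne (by decide) 1 (q + 1)) ?_
    rw [coeff_timeOp_iterate_of_ne (by decide), coeff_w1]
    simp
  have h1 := h.coeff_mul hL
  rw [add_zero, hL0, mul_one, coeff_timeOp_iterate_of_ne (by decide), coeff_w1] at h1
  simpa [rho, TimeDerivations.del] using h1

/-- `res_z z⁻² (∂₁^p w₂) L = 0` for every `L` of order at most zero. -/
lemma residue_w2_eq_zero {L : LaurentSeries A} (hL : VanishBelow 0 L) (p : ℕ) :
    ((timeOp F 1 (0, 1))^[p] (w2 F E a₂) * L).coeff (-1) = 0 :=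
  (((vanishBelow_w2 F E a₂).timeOp_iterate_of_ne (by decide) 1 p).mul hL) (-1) (by norm_num)

/-! ### From the hierarchy to the bilinear equation -/

/-- The module spanned by the pure derivatives `∂₁^p w` and `∂₂^q w`. -/
def pureSpan (w : Fin 2 → LaurentSeries A) : Submodule A (Fin 2 → LaurentSeries A) :=
  Submodule.span A (Set.range (fun p : ℕ => (timeAct F (0, 1))^[p] w) ∪
    Set.range fun q : ℕ => (timeAct F (1, 1))^[q] w)

section pureSpan
variable {F} {w : Fin 2 → LaurentSeries A} {b ρ : A}

lemma iterate_mem_pureSpan (ν : Fin 2) (p : ℕ) : (timeAct F (ν, 1))^[p] w ∈ pureSpan F w := by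
  apply Submodule.subset_span
  fin_cases ν
  · exact Or.inl ⟨p, rfl⟩
  · exact Or.inr ⟨p, rfl⟩

lemma iterate_comm (i j : Time) (p : ℕ) (v : Fin 2 → LaurentSeries A) :
    timeAct F i ((timeAct F j)^[p] v) = (timeAct F j)^[p] (timeAct F i v) := by
  have h : Function.Commute (timeAct F i) (timeAct F j) := timeAct_comm F i j
  exact (h.iterate_right p) v

/-- By `∂₁ ∂₂ w = b ∂₂ w + ρ w`, mixed derivatives are combinations of pure ones. -/
lemma timeAct_zero_mem_pureSpan
    (hw : timeAct F (0, 1) (timeAct F (1, 1) w) = b • timeAct F (1, 1) w + ρ • w)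
    {v : Fin 2 → LaurentSeries A} (hv : v ∈ pureSpan F w) : timeAct F (0, 1) v ∈ pureSpan F w := by
  -- The derivatives `∂₂^q w` span a module that is stable under `∂₂`.
  set N := Submodule.span A (Set.range fun q : ℕ => (timeAct F (1, 1))^[q] w)
  have hN : N ≤ pureSpan F w := Submodule.span_mono Set.subset_union_right
  have hiter : ∀ q : ℕ, ∀ v ∈ N, (timeAct F (1, 1))^[q] v ∈ N := by
    intro q v hv
    induction q with
    | zero => exact hv
    | succ q ih =>
      rw [Function.iterate_succ_apply']
      refine timeAct_mem_of_mem_span le_rfl ?_ ih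
      rintro _ ⟨q, rfl⟩
      exact Submodule.subset_span ⟨q + 1, Function.iterate_succ_apply' _ _ _⟩
  refine timeAct_mem_of_mem_span le_rfl ?_ hv
  rintro _ (⟨p, rfl⟩ | ⟨q, rfl⟩)
  · simp only [← Function.iterate_succ_apply' (timeAct F (0, 1))]
    exact iterate_mem_pureSpan 0 (p + 1)
  · obtain _ | q := q
    · exact iterate_mem_pureSpan 0 1
    · change timeAct F (0, 1) ((timeAct F (1, 1))^[q + 1] w) ∈ pureSpan F w
      rw [Function.iterate_succ_apply, iterate_comm, hw]
      exact hN (hiter q _ (N.add_mem (N.smul_mem _ (Submodule.subset_span ⟨1, rfl⟩))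
        (N.smul_mem _ (Submodule.subset_span ⟨0, rfl⟩))))

lemma timeAct_zero_iterate_mem_pureSpan
    (hw : timeAct F (0, 1) (timeAct F (1, 1) w) = b • timeAct F (1, 1) w + ρ • w) (p : ℕ)
    {v : Fin 2 → LaurentSeries A} (hv : v ∈ pureSpan F w) :
    (timeAct F (0, 1))^[p] v ∈ pureSpan F w := by
  induction p with
  | zero => exact hv
  | succ p ih => rw [Function.iterate_succ_apply']; exact timeAct_zero_mem_pureSpan hw ih

lemma timeAct_one_mem_pureSpan
    (hw : timeAct F (0, 1) (timeAct F (1, 1) w) = b • timeAct F (1, 1) w + ρ • w)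
    {v : Fin 2 → LaurentSeries A} (hv : v ∈ pureSpan F w) : timeAct F (1, 1) v ∈ pureSpan F w := by
  refine timeAct_mem_of_mem_span le_rfl ?_ hv
  rintro _ (⟨p, rfl⟩ | ⟨q, rfl⟩)
  · simp only [iterate_comm]
    exact timeAct_zero_iterate_mem_pureSpan hw p (iterate_mem_pureSpan 1 1)
  · simp only [← Function.iterate_succ_apply' (timeAct F (1, 1))]
    exact iterate_mem_pureSpan 1 (q + 1)

/-- The span of the pure derivatives is stable under `∂/∂t_i` as soon as it contains `∂w/∂t_i`. -/
lemma timeAct_mem_pureSpan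
    (hw : timeAct F (0, 1) (timeAct F (1, 1) w) = b • timeAct F (1, 1) w + ρ • w) {i : Time}
    (hi : timeAct F i w ∈ pureSpan F w) {v : Fin 2 → LaurentSeries A} (hv : v ∈ pureSpan F w) :
    timeAct F i v ∈ pureSpan F w := by
  refine timeAct_mem_of_mem_span le_rfl ?_ hv
  rintro _ (⟨p, rfl⟩ | ⟨q, rfl⟩)
  · simp only [iterate_comm]
    exact timeAct_zero_iterate_mem_pureSpan hw p hi
  · simp only [iterate_comm]
    induction q with
    | zero => exact hi
    | succ q ih => rw [Function.iterate_succ_apply']; exact timeAct_one_mem_pureSpan hw ih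

end pureSpan

/-- The pairing with the adjoint functions vanishes on the pure derivatives of a solution. -/
theorem IsSolution.bilinear (h : IsSolution F E a₁ a₂) :
    Bilinear F (w1 F a₁) (w1star F a₁) (w2 F E a₂) (w2star F E a₁ a₂) := by
  obtain ⟨hflow, hc⟩ := (isSolution_iff F E a₁ a₂).1 h
  refine (bilinear_iff_exists_stable F (waves F E a₁ a₂) ![w1star F a₁, w2star F E a₁ a₂]).2
    ⟨pureSpan F _, iterate_mem_pureSpan 0 0, fun i v hv => timeAct_mem_pureSpan hc ?_ hv, ?_⟩
  · obtain ⟨ν, k⟩ := i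
    rw [hflow]
    exact Submodule.sum_mem _ fun j _ => Submodule.smul_mem _ _ (iterate_mem_pureSpan ν j)
  · have hle : pureSpan F (waves F E a₁ a₂) ≤
        LinearMap.ker (pairing ![w1star F a₁, w2star F E a₁ a₂]) := by
      have key : ∀ p : ℕ, pairing ![w1star F a₁, w2star F E a₁ a₂]
          ((timeAct F (0, 1))^[p] (waves F E a₁ a₂)) = 0 := fun p => by
        rw [pairing_apply, timeAct_iterate_apply, timeAct_iterate_apply]
        refine (congrArg₂ _ (residue_w1_w1star F a₁ p) (residue_w2_eq_zero F E a₂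
          (vanishBelow_w2star F E a₁ a₂) p)).trans (sub_zero 0)
      refine Submodule.span_le.2 ?_
      rintro _ (⟨p, rfl⟩ | ⟨_ | q, rfl⟩)
      · exact key p
      · exact key 0
      · simp only [SetLike.mem_coe, LinearMap.mem_ker]
        rw [pairing_apply, timeAct_iterate_apply, timeAct_iterate_apply]
        exact sub_eq_zero.2 ((residue_w1_of_coeff_zero_eq_one F a₁ (vanishBelow_w1star F a₁)
          (coeff_zero_w1star F a₁) q).trans (residue_w2_w2star F E a₁ a₂ q).symm)
    exact fun v hv => hle hv

/-! ### From the bilinear equation to the hierarchy -/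

section converse
variable {F E a₁ a₂}

/-- The difference of the two sides of a flow equation has a first component of order at most `-1`
and a second component of order at most `0`. -/
lemma vanishBelow_flow (ν : Fin 2) (k : ℕ+) :
    VanishBelow 1 ((timeAct F (ν, k) (waves F E a₁ a₂) - flowRhs F E a₁ a₂ ν k) 0) ∧
      VanishBelow 0 ((timeAct F (ν, k) (waves F E a₁ a₂) - flowRhs F E a₁ a₂ ν k) 1) := by
  obtain ⟨h1, h2, h3⟩ := Phi1_inv F a₁
  obtain ⟨h4, h5, h6⟩ := Phi2_inv F E a₂
  have hP := ordLE_Phi1 F a₁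
  have hQ := ordLE_Phi2 F E a₂
  -- The components along the other times have no positive powers of `z`.
  have other : ∀ ν μ : Fin 2, ν ≠ μ → VanishBelow 0 (waves F E a₁ a₂ μ) →
      VanishBelow 0 ((timeAct F (ν, k) (waves F E a₁ a₂) - flowRhs F E a₁ a₂ ν k) μ) := by
    intro ν μ hμ hw j hj
    rw [Pi.sub_apply, HahnSeries.coeff_sub, flowRhs_apply, HahnSeries.coeff_sum,
      Finset.sum_eq_zero, sub_zero]
    · exact hw.timeOp_iterate_of_ne hμ k 1 j hj
    · intro i _
      rw [HahnSeries.coeff_smul, hw.timeOp_iterate_of_ne hμ 1 i j hj, smul_zero]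
  fin_cases ν
  · refine ⟨?_, other 0 1 (by decide) (vanishBelow_w2 F E a₂)⟩
    have e : (timeAct F (0, k) (waves F E a₁ a₂) - flowRhs F E a₁ a₂ 0 k) 0 =
        ampPos 0 (dt (0, k) (Phi1 F a₁) +
          truncLT 0 0 (lax 0 (Phi1 F a₁) ^ (k : ℕ)) * Phi1 F a₁) := by
      rw [← timeOp_ampPos_sub hP h1 h3 h2 le_rfl, Pi.sub_apply, flowRhs_apply]
      rfl
    change VanishBelow 1 ((timeAct F (0, k) (waves F E a₁ a₂) - flowRhs F E a₁ a₂ 0 k) 0)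
    rw [e]
    have ho := ((ordLE_lax_pow hP h1 h3 h2 k).truncLT 0).mul hP
    refine VanishBelow.succ (a := 0) ?_ ?_
    · exact vanishBelow_ampPos (n := 0) ((hP.dt _).add (ho.mono (by norm_num)))
    · rw [coeff_ampPos, coeff_add, ho.coeff_eq_zero (by norm_num), neg_zero, Pi.single_zero]
      simp [dt, coeff_zero_Phi1]
  · constructor
    · refine VanishBelow.succ (a := 0) (other 1 0 (by decide) (vanishBelow_w1 F a₁)) ?_
      have hw : (waves F E a₁ a₂ 0).coeff 0 = 1 := by rw [waves_zero, coeff_w1]; simp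
      change ((timeAct F (1, k) (waves F E a₁ a₂) - flowRhs F E a₁ a₂ 1 k) 0).coeff 0 = 0
      rw [Pi.sub_apply, HahnSeries.coeff_sub, flowRhs_apply, HahnSeries.coeff_sum,
        Finset.sum_eq_zero, sub_zero, timeAct_apply, coeff_timeOp, hw]
      · simp
      · intro j _
        rw [HahnSeries.coeff_smul, coeff_timeOp_iterate_of_ne (by decide), hw]
        obtain _ | j := j
        · have : (flowOp F E a₁ a₂ 1 k).coeff (Pi.single 1 ((0 : ℕ) : ℤ)) = 0 :=
            coeff_truncGE_of_lt (by norm_num) _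
          rw [this, zero_smul]
        · rw [Function.iterate_succ_apply, Derivation.map_one_eq_zero, iterate_D_zero, smul_zero]
    · have e : (timeAct F (1, k) (waves F E a₁ a₂) - flowRhs F E a₁ a₂ 1 k) 1 =
          ampPos 1 (dt (1, k) (Phi2 F E a₂) +
            truncLT 1 1 (lax 1 (Phi2 F E a₂) ^ (k : ℕ)) * Phi2 F E a₂) := by
        rw [← timeOp_ampPos_sub hQ h4 h6 h5 zero_le_one, Pi.sub_apply, flowRhs_apply]
        rfl
      change VanishBelow 0 ((timeAct F (1, k) (waves F E a₁ a₂) - flowRhs F E a₁ a₂ 1 k) 1)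
      rw [e]
      exact vanishBelow_ampPos (n := 0) ((hQ.dt _).add
        ((((ordLE_lax_pow hQ h4 h6 h5 k).truncLT 1).mul hQ).mono (by norm_num)))

/-- The difference of the two sides of `∂₁ ∂₂ w = (∂₁ β) ∂₂ w + ρ w` has a first component of order
at most `-1` and a second component of order at most `0`. -/
lemma vanishBelow_constraint :
    VanishBelow 1 ((timeAct F (0, 1) (timeAct F (1, 1) (waves F E a₁ a₂)) -
        ((F.D (0, 1) E * ((E⁻¹ : Aˣ) : A)) • timeAct F (1, 1) (waves F E a₁ a₂) +
          rho F a₁ • waves F E a₁ a₂)) 0) ∧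
      VanishBelow 0 ((timeAct F (0, 1) (timeAct F (1, 1) (waves F E a₁ a₂)) -
        ((F.D (0, 1) E * ((E⁻¹ : Aˣ) : A)) • timeAct F (1, 1) (waves F E a₁ a₂) +
          rho F a₁ • waves F E a₁ a₂)) 1) := by
  constructor
  · intro j hj
    simp only [Pi.sub_apply, Pi.add_apply, Pi.smul_apply, timeAct_apply, waves_zero,
      HahnSeries.coeff_sub, HahnSeries.coeff_add, HahnSeries.coeff_smul, coeff_timeOp, coeff_w1,
      smul_eq_mul]
    obtain hj | rfl | rfl : j < -1 ∨ j = -1 ∨ j = 0 := by omega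
    · have h1 : j < 0 := by omega
      have h2 : j + 1 < 0 := by omega
      simp [h1, h2]
    · simp
    · simp [rho, TimeDerivations.del]
  · intro j hj
    simp only [Pi.sub_apply, Pi.add_apply, Pi.smul_apply, timeAct_apply, waves_one,
      HahnSeries.coeff_sub, HahnSeries.coeff_add, HahnSeries.coeff_smul, coeff_timeOp, coeff_w2,
      smul_eq_mul]
    obtain hj | rfl : j < -1 ∨ j = -1 := by omega
    · have h1 : j < 0 := by omega
      have h2 : j + 1 < 0 := by omega
      simp [h1, h2]
    · simp [mul_assoc]

/-- The bilinear equation determines the adjoint functions and implies the hierarchy. -/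
theorem isSolution_of_bilinear {Ls : Fin 2 → LaurentSeries A} (h0 : VanishBelow 0 (Ls 0))
    (h1 : VanishBelow 0 (Ls 1)) (hc0 : (Ls 0).coeff 0 = 1)
    (hρ : F.D (1, 1) (a₁ 1) ∈ nonZeroDivisors A)
    (h : Bilinear F (w1 F a₁) (Ls 0) (w2 F E a₂) (Ls 1)) :
    IsSolution F E a₁ a₂ ∧ Ls 0 = w1star F a₁ ∧ Ls 1 = w2star F E a₁ a₂ := by
  obtain ⟨N, hw, hN, hpair⟩ := (bilinear_iff_exists_stable F (waves F E a₁ a₂) Ls).1 h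
  have hiter : ∀ i p, (timeAct F i)^[p] (waves F E a₁ a₂) ∈ N := by
    intro i p
    induction p with
    | zero => exact hw
    | succ p ih => rw [Function.iterate_succ_apply']; exact hN i _ ih
  have hu1 : (w1 F a₁).coeff 0 = ((1 : Aˣ) : A) := by rw [coeff_w1]; simp
  have hu2 : (w2 F E a₂).coeff 0 = (E : A) := by rw [coeff_w2]; simp
  have r1 : ∀ p, ((timeOp F 0 (0, 1))^[p] (w1 F a₁) * Ls 0).coeff 1 = 0 := fun p => by
    have h2 := hpair _ (hiter (0, 1) p)
    rw [pairing_apply, timeAct_iterate_apply, timeAct_iterate_apply, waves_one,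
      residue_w2_eq_zero F E a₂ h1, sub_zero] at h2
    exact h2
  have r2 : ∀ q, ((timeOp F 1 (1, 1))^[q + 1] (w2 F E a₂) * Ls 1).coeff (-1) =
      (F.D (1, 1))^[q] (rho F a₁) := fun q => by
    have h2 := hpair _ (hiter (1, 1) (q + 1))
    rw [pairing_apply, timeAct_iterate_apply, timeAct_iterate_apply, waves_zero,
      residue_w1_of_coeff_zero_eq_one F a₁ h0 hc0, sub_eq_zero] at h2
    exact h2.symm
  have e1 : Ls 0 = w1star F a₁ := by
    refine eq_of_coeff_timeOp_mul_eq 1 1 0 (by norm_num) (vanishBelow_w1 F a₁) hu1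
      (VanishBelow.succ (a := 0) (h0.sub (vanishBelow_w1star F a₁)) ?_)
      fun p => (r1 p).trans (residue_w1_w1star F a₁ p).symm
    rw [HahnSeries.coeff_sub, hc0, coeff_zero_w1star, sub_self]
  have e2 : Ls 1 = w2star F E a₁ a₂ :=
    eq_of_coeff_timeOp_mul_eq (-1) 0 1 (by norm_num) (vanishBelow_w2 F E a₂) hu2
      (h1.sub (vanishBelow_w2star F E a₁ a₂))
      fun q => (r2 q).trans (residue_w2_w2star F E a₁ a₂ q).symm
  have hc1 : (Ls 1).coeff 0 ∈ nonZeroDivisors A := by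
    obtain ⟨h2, h3⟩ := (vanishBelow_w2 F E a₂).timeOp_iterate F 1 1
    have h4 := h2.coeff_mul h1
    rw [h3, hu2] at h4
    have h5 : (E : A) * (Ls 1).coeff 0 = rho F a₁ := h4.symm.trans (r2 0)
    have h6 : (Ls 1).coeff 0 = ((E⁻¹ : Aˣ) : A) * F.D (1, 1) (a₁ 1) := by
      rw [← Units.eq_inv_mul_iff_mul_eq] at h5
      exact h5
    rw [h6]
    exact mul_mem (Units.isUnit _).mem_nonZeroDivisors hρ
  refine ⟨(isSolution_iff F E a₁ a₂).2 ⟨fun ν k => ?_, ?_⟩, e1, e2⟩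
  · obtain ⟨v0, v1⟩ := vanishBelow_flow (F := F) (E := E) (a₁ := a₁) (a₂ := a₂) ν k
    refine sub_eq_zero.1 (eq_zero_of_mem_stable hN hpair h0 h1 hc0 hc1 (N.sub_mem (hN _ _ hw)
      (Submodule.sum_mem _ fun j _ => N.smul_mem _ (hiter _ j))) v0 v1)
  · obtain ⟨v0, v1⟩ := vanishBelow_constraint (F := F) (E := E) (a₁ := a₁) (a₂ := a₂)
    refine sub_eq_zero.1 (eq_zero_of_mem_stable hN hpair h0 h1 hc0 hc1 (N.sub_mem
      (hN _ _ (hN _ _ hw)) (N.add_mem (N.smul_mem _ (hN _ _ hw)) (N.smul_mem _ hw))) v0 v1)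

end converse

end

end KPmKP

end

theorem theorem5p2 {A : Type*} [CommRing A] [Algebra ℂ A] (F : KPmKP.TimeDerivations A) :
    (∀ (E : Aˣ) (a₁ a₂ : ℕ → A), KPmKP.IsSolution F E a₁ a₂ →
      KPmKP.Bilinear F (KPmKP.w1 F a₁) (KPmKP.w1star F a₁)
        (KPmKP.w2 F E a₂) (KPmKP.w2star F E a₁ a₂)) ∧
    (∀ (E : Aˣ) (a₁ a₂ b₁ b₂ : ℕ → A) (r : A) (w₁ w₂ w₁star w₂star : LaurentSeries A),
      w₁ = KPmKP.tailSeries 1 a₁ →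
      w₂ = HahnSeries.C (E : A) * KPmKP.tailSeries 1 a₂ →
      w₁star = KPmKP.tailSeries 1 b₁ →
      w₂star = HahnSeries.C ((E⁻¹ : Aˣ) : A) * KPmKP.tailSeries r b₂ →
      F.D (1, 1) (a₁ 1) ∈ nonZeroDivisors A →
      KPmKP.Bilinear F w₁ w₁star w₂ w₂star →
      KPmKP.IsSolution F E a₁ a₂ ∧
        w₁ = KPmKP.w1 F a₁ ∧ w₂ = KPmKP.w2 F E a₂ ∧
        w₁star = KPmKP.w1star F a₁ ∧ w₂star = KPmKP.w2star F E a₁ a₂) := by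
  refine ⟨fun E a₁ a₂ h => h.bilinear, ?_⟩
  rintro E a₁ a₂ b₁ b₂ r _ _ _ _ rfl rfl rfl rfl hρ h
  rw [← KPmKP.w1_eq_tailSeries F, ← KPmKP.w2_eq_tailSeries F] at h ⊢
  have h1 : ∀ c b, KPmKP.VanishBelow 0 (KPmKP.tailSeries (A := A) c b) := fun c b j hj => by
    rw [KPmKP.coeff_tailSeries, if_pos hj]
  obtain ⟨hs, e1, e2⟩ := KPmKP.isSolution_of_bilinear
    (Ls := ![KPmKP.tailSeries 1 b₁, HahnSeries.C ((E⁻¹ : Aˣ) : A) * KPmKP.tailSeries r b₂])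
    (h1 1 b₁) (fun j hj => by
      change (HahnSeries.C ((E⁻¹ : Aˣ) : A) * KPmKP.tailSeries r b₂).coeff j = 0
      rw [HahnSeries.C_mul_eq_smul, HahnSeries.coeff_smul, h1 r b₂ j hj, smul_zero])
    ((KPmKP.coeff_tailSeries 1 b₁ 0).trans (by simp)) hρ h
  exact ⟨hs, rfl, rfl, e1, e2⟩
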